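/- Let $T^1,\dots,T^8$ be Hermitian traceless $3\times 3$ matrices with $\mathrm{tr}(T^AT^B)=\tfrac12\delta_{AB}$ (generators of $SU(3)$), with structure constants $f_{ABC}$ given by $[T^A,T^B]=i\sum_C f_{ABC}T^C$. Let $a_A,a_A^\dagger$ ($A=1,\dots,8$) be bosonic annihilation and creation operators, acting on the Fock states $p(a^\dagger)|0\rangle$ ($p$ a complex polynomial in eight variables), put $\phi_A=\frac{1}{\sqrt2}(a_A+a_A^\dagger)$, $\pi_A=\frac{1}{i\sqrt2}(a_A-a_A^\dagger)$, let $a=\sum_A a_AT^A$, $a^\dagger=\sum_A a_A^\dagger T^A$ be operator-valued matrices, and let $$H=\mathrm{tr}(a^\dagger a)+2-\tfrac12\mathrm{tr}(a^\dagger a^\dagger)-\tfrac12\mathrm{tr}(aa).$$ Let $N\ge 0$ be an integer (the cut-off $N_{cut}$), and let $\mathcal H_N$ be the cut bosonic ($n_F=0$) sector: the space of gauge-invariant Fock states, i.e. those with $\sum_{B,C}f_{ABC}\phi_B\pi_C|\psi\rangle=0$ for all $A$, with at most $N$ quanta. Let $P_N$ be the orthogonal projection onto the states with at most $N$ quanta.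 A solution at cut-off $N$ with energy $E\in\mathbb C$ is a nonzero $|\psi\rangle\in\mathcal H_N$ with $P_NH|\psi\rangle=E|\psi\rangle$. Write $|j,k\rangle=\mathrm{tr}(a^\dagger a^\dagger)^j\,\mathrm{tr}(a^\dagger a^\dagger a^\dagger)^k|0\rangle$. Let $L_n^\alpha(x)=\mathcal L_n^\alpha(x)/\Gamma(n+\alpha+1)$, where $\mathcal L_n^\alpha(x)=\sum_{i=0}^n(-1)^i\binom{n+\alpha}{n-i}\frac{x^i}{i!}$ is the generalized Laguerre polynomial. For $0\le t\le\kappa$ put $$\Gamma^{even}_{\kappa-1,t}=(-24)^{t-\kappa}\frac{(\kappa+t)!}{(\kappa-t)!\,(2t)!},\qquad \Gamma^{odd}_{\kappa-1,t}=(-24)^{t-\kappa}\frac{(\kappa+t+1)!}{(\kappa-t)!\,(2t+1)!},$$ $$\overline{|n,2\kappa\rangle}=|n,2\kappa\rangle+\sum_{t=1}^{\kappa}\Gamma^{even}_{\kappa-1,\kappa-t}|n+3t,2\kappa-2t\rangle,\qquad \overline{|n,2\kappa+1\rangle}=|n,2\kappa+1\rangle+\sum_{t=1}^{\kappa}\Gamma^{odd}_{\kappa-1,\kappa-t}|n+3t,2\kappa-2t+1\rangle.$$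 Then the states $|j,k\rangle$ with $2j+3k\le N$ form a basis of $\mathcal H_N$, and the following holds. 1. (Families $f_\kappa$.) Let $\kappa\ge0$, $6\kappa\le N$, and $d_\kappa=\lfloor (N-6\kappa)/2\rfloor+1$. The equation $L^{6\kappa+3}_{d_\kappa}(2E)=0$ has exactly $d_\kappa$ distinct real roots $E$, all positive, and for each of them $$|E,\kappa\rangle_{even}=(2E)^{3\kappa}e^{-E}\sum_{n=0}^{d_\kappa-1}L_n^{6\kappa+3}(2E)\,\overline{|n,2\kappa\rangle}$$ is a solution at cut-off $N$ with energy $E$. It belongs to the family $f_\kappa$: the numbers $k$ for which some $|j,k\rangle$ occurs in it with nonzero coefficient are exactly the even $k\le2\kappa$. 2. (Families $g_\kappa$.) Let $\kappa\ge0$, $6\kappa+3\le N$, and $d'_\kappa=\lfloor (N-6\kappa-3)/2\rfloor+1$. The equation $L^{6\kappa+6}_{d'_\kappa}(2E)=0$ has exactly $d'_\kappa$ distinct real roots $E$, all positive, and for each of them $$|E,\kappa\rangle_{odd}=(2E)^{3\kappa+\frac32}e^{-E}\sum_{n=0}^{d'_\kappa-1}L_n^{6\kappa+6}(2E)\,\overline{|n,2\kappa+1\rangle}$$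 is a solution at cut-off $N$ with energy $E$. It belongs to the family $g_\kappa$: the numbers $k$ for which some $|j,k\rangle$ occurs in it with nonzero coefficient are exactly the odd $k\le2\kappa+1$. 3. (Completeness.) The solutions in 1 and 2, for all admissible $\kappa$, together form a basis of $\mathcal H_N$. For every $E\in\mathbb C$, the space of all $|\psi\rangle\in\mathcal H_N$ with $P_NH|\psi\rangle=E|\psi\rangle$ is spanned by those solutions in 1 and 2 that have energy $E$. 4. (Spectrum.) Let $$\Theta^{n_F=0}_{N}(E)=\prod_{k=0}^{\lfloor N/3\rfloor}L^{3k+3}_{\lfloor (N-3k)/2\rfloor+1}(2E).$$ Then $\Theta^{n_F=0}_N(E)=\prod_{\kappa\ge0,\,6\kappa\le N}L^{6\kappa+3}_{d_\kappa}(2E)\cdot\prod_{\kappa\ge0,\,6\kappa+3\le N}L^{6\kappa+6}_{d'_\kappa}(2E)$, and a number $E\in\mathbb C$ is the energy of a solution at cut-off $N$ if and only if $\Theta^{n_F=0}_N(E)=0$. -/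

import Mathlib

noncomputable section

open Polynomial in
/-- The generalized Laguerre polynomial `𝓛_n^α(x) = ∑_{i=0}^n (-1)^i (n+α choose n-i) x^i / i!`
for an integer parameter `α ≥ 0`. -/
def laguerre (n α : ℕ) : ℝ[X] :=
  ∑ i ∈ Finset.range (n + 1),
    C ((-1 : ℝ) ^ i * ((n + α).choose (n - i) : ℝ) / (i.factorial : ℝ)) * X ^ i

open Polynomial in
/-- The rescaled Laguerre (Sonine) polynomial `L_n^α = 𝓛_n^α / Γ(n+α+1)`. -/
def sonine (n α : ℕ) : ℝ[X] :=
  C (Real.Gamma ((n : ℝ) + α + 1))⁻¹ * laguerre n α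

/-- `T` is a system of generators of `SU(3)` in the fundamental representation with the usual
normalization: Hermitian, traceless, `tr (T^A T^B) = δ_{AB} / 2`. -/
def IsSU3Generators (T : Fin 8 → Matrix (Fin 3) (Fin 3) ℂ) : Prop :=
  (∀ A, (T A).IsHermitian) ∧ (∀ A, (T A).trace = 0) ∧
    ∀ A B, (T A * T B).trace = if A = B then 1 / 2 else 0

/-- Structure constants `f_{ABC}`, determined by `[T^A, T^B] = i f_{ABC} T^C`. -/
def structureConst (T : Fin 8 → Matrix (Fin 3) (Fin 3) ℂ) (A B C : Fin 8) : ℂ :=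
  -2 * Complex.I * ((T A * T B - T B * T A) * T C).trace

/-- Fock states with finitely many quanta of the eight bosonic oscillators and no fermion
(`n_F = 0`): the polynomial `p` stands for the state `p(a†)|0⟩`, where `|0⟩` is the vacuum `1`. -/
abbrev Fock : Type := MvPolynomial (Fin 8) ℂ

/-- The creation operator `a†_A`. -/
def creation (A : Fin 8) : Module.End ℂ Fock :=
  LinearMap.mulLeft ℂ (MvPolynomial.X A : Fock)

/-- The annihilation operator `a_A`. -/
def annihilation (A : Fin 8) : Module.End ℂ Fock :=
  (MvPolynomial.pderiv A : Derivation ℂ Fock Fock).toLinearMap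

/-- The field operator `φ_A = (a_A + a†_A) / √2`. -/
def fieldOp (A : Fin 8) : Module.End ℂ Fock :=
  ((Real.sqrt 2 : ℝ) : ℂ)⁻¹ • (annihilation A + creation A)

/-- The momentum operator `π_A = (a_A - a†_A) / (i √2)`. -/
def momentumOp (A : Fin 8) : Module.End ℂ Fock :=
  (Complex.I * ((Real.sqrt 2 : ℝ) : ℂ))⁻¹ • (annihilation A - creation A)

/-- The gauge generator `G_A = f_{ABC} φ_B π_C`. Its fermionic part
`-i f_{ABC} λ̄_B λ_C` vanishes on states without fermions. -/
def gaugeGenerator (T : Fin 8 → Matrix (Fin 3) (Fin 3) ℂ) (A : Fin 8) : Module.End ℂ Fock :=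
  ∑ B, ∑ C, structureConst T A B C • (fieldOp B * momentumOp C)

/-- The operator-valued matrix `a†_{ij} = a†_A T^A_{ij}`. -/
def creationMatrix (T : Fin 8 → Matrix (Fin 3) (Fin 3) ℂ) :
    Matrix (Fin 3) (Fin 3) (Module.End ℂ Fock) :=
  Matrix.of fun i j => ∑ A, T A i j • creation A

/-- The operator-valued matrix `a_{ij} = a_A T^A_{ij}`. -/
def annihilationMatrix (T : Fin 8 → Matrix (Fin 3) (Fin 3) ℂ) :
    Matrix (Fin 3) (Fin 3) (Module.End ℂ Fock) :=
  Matrix.of fun i j => ∑ A, T A i j • annihilation A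

/-- The Hamiltonian `H = tr(a†a) + 2 - tr(a†a†)/2 - tr(aa)/2`. -/
def hamiltonian (T : Fin 8 → Matrix (Fin 3) (Fin 3) ℂ) : Module.End ℂ Fock :=
  (creationMatrix T * annihilationMatrix T).trace + (2 : ℂ) • (1 : Module.End ℂ Fock)
    - (1 / 2 : ℂ) • (creationMatrix T * creationMatrix T).trace
    - (1 / 2 : ℂ) • (annihilationMatrix T * annihilationMatrix T).trace

/-- The physical states of the bosonic sector with at most `N` quanta: the solutions of the
Gauss law `G_A |ψ⟩ = 0` whose polynomial has total degree at most `N`. -/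
def cutSpace (T : Fin 8 → Matrix (Fin 3) (Fin 3) ℂ) (N : ℕ) : Submodule ℂ Fock :=
  (⨅ A, LinearMap.ker (gaugeGenerator T A)) ⊓ MvPolynomial.restrictTotalDegree (Fin 8) ℂ N

/-- The orthogonal projection onto the states with at most `N` quanta (states with different
numbers of quanta are orthogonal). -/
def cutProjection (N : ℕ) : Module.End ℂ Fock :=
  ∑ n ∈ Finset.range (N + 1), MvPolynomial.homogeneousComponent n

/-- The solutions `|E⟩`, zero included, of the eigenvalue problem `P_N H |E⟩ = E |E⟩` of the
cut Hamiltonian in the space of physical states with at most `N` quanta. -/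
def cutEigenspace (T : Fin 8 → Matrix (Fin 3) (Fin 3) ℂ) (N : ℕ) (E : ℂ) : Submodule ℂ Fock :=
  cutSpace T N ⊓
    LinearMap.ker (cutProjection N * hamiltonian T - E • (1 : Module.End ℂ Fock))

/-- The Fock state `|j, k⟩ = (a†a†)^j (a†a†a†)^k |0⟩`. -/
def brickState (T : Fin 8 → Matrix (Fin 3) (Fin 3) ℂ) (j k : ℕ) : Fock :=
  ((creationMatrix T * creationMatrix T).trace ^ j *
    (creationMatrix T * creationMatrix T * creationMatrix T).trace ^ k) (1 : Fock)

/-- `Γ^even_{κ-1,t}`, for `t ≤ κ`. -/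
def gammaEven (κ t : ℕ) : ℂ :=
  (-24 : ℂ) ^ ((t : ℤ) - (κ : ℤ)) *
    (((κ + t).factorial : ℂ) / (((κ - t).factorial : ℂ) * ((2 * t).factorial : ℂ)))

/-- `Γ^odd_{κ-1,t}`, for `t ≤ κ`. -/
def gammaOdd (κ t : ℕ) : ℂ :=
  (-24 : ℂ) ^ ((t : ℤ) - (κ : ℤ)) *
    (((κ + t + 1).factorial : ℂ) / (((κ - t).factorial : ℂ) * ((2 * t + 1).factorial : ℂ)))

/-- The mixed Fock state `|n, 2κ⟩` with an overline. -/
def mixedEven (T : Fin 8 → Matrix (Fin 3) (Fin 3) ℂ) (n κ : ℕ) : Fock :=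
  brickState T n (2 * κ) +
    ∑ t ∈ Finset.Icc 1 κ, gammaEven κ (κ - t) • brickState T (n + 3 * t) (2 * κ - 2 * t)

/-- The mixed Fock state `|n, 2κ+1⟩` with an overline. -/
def mixedOdd (T : Fin 8 → Matrix (Fin 3) (Fin 3) ℂ) (n κ : ℕ) : Fock :=
  brickState T n (2 * κ + 1) +
    ∑ t ∈ Finset.Icc 1 κ, gammaOdd κ (κ - t) • brickState T (n + 3 * t) (2 * κ - 2 * t + 1)

/-- `d_κ(N) = ⌊(N - 6κ)/2⌋ + 1`, for `6κ ≤ N`. -/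
def dEven (N κ : ℕ) : ℕ := (N - 6 * κ) / 2 + 1

/-- `d'_κ(N) = ⌊(N - 6κ - 3)/2⌋ + 1`, for `6κ + 3 ≤ N`. -/
def dOdd (N κ : ℕ) : ℕ := (N - 6 * κ - 3) / 2 + 1

/-- The state `|E, κ⟩_even` at cut-off `N`. -/
def evenState (T : Fin 8 → Matrix (Fin 3) (Fin 3) ℂ) (N κ : ℕ) (E : ℝ) : Fock :=
  (((2 * E) ^ (3 * κ) * Real.exp (-E) : ℝ) : ℂ) •
    ∑ n ∈ Finset.range (dEven N κ),
      (((sonine n (6 * κ + 3)).eval (2 * E) : ℝ) : ℂ) • mixedEven T n κ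

/-- The state `|E, κ⟩_odd` at cut-off `N`. -/
def oddState (T : Fin 8 → Matrix (Fin 3) (Fin 3) ℂ) (N κ : ℕ) (E : ℝ) : Fock :=
  (((2 * E) ^ (3 * (κ : ℝ) + 3 / 2) * Real.exp (-E) : ℝ) : ℂ) •
    ∑ n ∈ Finset.range (dOdd N κ),
      (((sonine n (6 * κ + 6)).eval (2 * E) : ℝ) : ℂ) • mixedOdd T n κ

/-- The energies of the family `f_κ` at cut-off `N`. -/
def evenEnergies (N κ : ℕ) : Set ℝ :=
  {E | (sonine (dEven N κ) (6 * κ + 3)).eval (2 * E) = 0}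

/-- The energies of the family `g_κ` at cut-off `N`. -/
def oddEnergies (N κ : ℕ) : Set ℝ :=
  {E | (sonine (dOdd N κ) (6 * κ + 6)).eval (2 * E) = 0}

/-- Labels `(κ, E)` of the solutions in the families `f_κ` present at cut-off `N`. -/
def EvenLabel (N : ℕ) : Type :=
  {p : ℕ × ℝ // 6 * p.1 ≤ N ∧ p.2 ∈ evenEnergies N p.1}

/-- Labels `(κ, E)` of the solutions in the families `g_κ` present at cut-off `N`. -/
def OddLabel (N : ℕ) : Type :=
  {p : ℕ × ℝ // 6 * p.1 + 3 ≤ N ∧ p.2 ∈ oddEnergies N p.1}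

/-- All the solutions at cut-off `N`, by label. -/
def solution (T : Fin 8 → Matrix (Fin 3) (Fin 3) ℂ) (N : ℕ) : EvenLabel N ⊕ OddLabel N → Fock :=
  Sum.elim (fun p => evenState T N p.1.1 p.1.2) (fun p => oddState T N p.1.1 p.1.2)

/-- The energy of a label. -/
def energy (N : ℕ) : EvenLabel N ⊕ OddLabel N → ℝ :=
  Sum.elim (fun p => p.1.2) (fun p => p.1.2)

/-- The pairs `(j, k)` with `2j + 3k ≤ N`. -/
def brickIndices (N : ℕ) : Finset (ℕ × ℕ) :=
  (Finset.range (N + 1) ×ˢ Finset.range (N + 1)).filter fun p => 2 * p.1 + 3 * p.2 ≤ N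

/-- `ψ = ∑_{2j+3k ≤ N} a_{j,k} |j, k⟩`, where the indices `k` with some `a_{j,k} ≠ 0` are exactly
those `k ≤ K` that have the parity of `K`. The family `f_κ` is the case `K = 2κ`, and the
family `g_κ` is the case `K = 2κ + 1`. -/
def InFamily (T : Fin 8 → Matrix (Fin 3) (Fin 3) ℂ) (N K : ℕ) (ψ : Fock) : Prop :=
  ∃ a : ℕ × ℕ → ℂ, ψ = ∑ p ∈ brickIndices N, a p • brickState T p.1 p.2 ∧
    ∀ k, (∃ j, (j, k) ∈ brickIndices N ∧ a (j, k) ≠ 0) ↔ k ≤ K ∧ k % 2 = K % 2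

open Polynomial in
/-- `Θ_N(E) = ∏_{k=0}^{⌊N/3⌋} L^{3k+3}_{⌊(N-3k)/2⌋+1}(2E)`, as a polynomial in `E`. -/
def thetaPoly (N : ℕ) : ℝ[X] :=
  ∏ k ∈ Finset.range (N / 3 + 1), (sonine ((N - 3 * k) / 2 + 1) (3 * k + 3)).comp (C 2 * X)

end

/-!
A Fock state is a polynomial function on the traceless matrices `Y = ∑ x_A T^A`, and the Gauss law
says that its derivatives along the vector fields `Y ↦ [T^A, Y]` vanish. Exponentiating, it is
invariant under conjugation by all of `GL₃(ℂ)`; almost every `Y` is conjugate to a companion matrix,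
so an invariant polynomial is determined by its restriction to companion matrices, and hence is a
polynomial in `tr Y²` and `tr Y³`.

The Hamiltonian is `deg / 2 + 2 - tr Y² / 2 - Δ / 4`, where `deg` multiplies a homogeneous
polynomial by its degree and `Δ` is the Laplacian in the coordinates `x_A`. The overlined state
`|0, K⟩` is the harmonic polynomial with leading term `(tr Y³)^K`. Its products with the powers of
`tr Y²` span an invariant sector in which `H` is tridiagonal, with the coefficients of the
three-term recurrence of the Laguerre polynomials with parameter `3K + 3`. The cut-off truncates the
sector after `d` states, and `E` is an eigenvalue of the truncation when the boundary term, a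
multiple of `L_d^{3K+3}(2E)`, vanishes. The Christoffel–Darboux identity shows that this polynomial
has `d` distinct real roots, so each sector has an eigenbasis, and the sectors together exhaust the
invariant polynomials.
-/

namespace SU3Fock

section Laguerre

open Polynomial ComplexConjugate

theorem sonine_coeff (n α i : ℕ) :
    (sonine n α).coeff i =
      (-1) ^ i * (n.choose i / (n.factorial * (α + i).factorial : ℝ)) := by
  have hGamma : Real.Gamma ((n : ℝ) + α + 1) = (n + α).factorial := by
    exact_mod_cast Real.Gamma_nat_eq_factorial (n + α)
  simp only [sonine, laguerre, coeff_C_mul, finsetSum_coeff, coeff_X_pow, hGamma, mul_ite, mul_one,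
    mul_zero, Finset.sum_ite_eq, Finset.mem_range, Nat.lt_succ_iff]
  split_ifs with hi
  · obtain ⟨m, rfl⟩ := Nat.exists_eq_add_of_le hi
    rw [add_tsub_cancel_left, show i + m + α = m + (α + i) by ring, Nat.cast_add_choose,
      Nat.cast_add_choose]
    field_simp
  · simp [Nat.choose_eq_zero_of_lt (not_le.1 hi)]

theorem sonine_natDegree (n α : ℕ) : (sonine n α).natDegree = n := by
  refine natDegree_eq_of_le_of_coeff_ne_zero ?_ ?_
  · rw [natDegree_le_iff_coeff_eq_zero]
    intro i hi
    simp [sonine_coeff, Nat.choose_eq_zero_of_lt hi]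
  · rw [sonine_coeff, Nat.choose_self]
    positivity

theorem sonine_zero (α : ℕ) : sonine 0 α = C (α.factorial : ℝ)⁻¹ := by
  rw [eq_C_of_natDegree_eq_zero (sonine_natDegree 0 α)]
  simp [sonine_coeff]

theorem sonine_one (α : ℕ) :
    C (1 + α : ℝ) * sonine 1 α = (C (1 + α : ℝ) - X) * sonine 0 α := by
  ext i
  rw [sub_mul, coeff_sub, coeff_C_mul, coeff_C_mul]
  rcases i with _ | _ | i
  · simp [sonine_coeff]
  · simp only [coeff_X_mul, sonine_coeff, Nat.factorial_succ, ← add_assoc]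
    simp
    field_simp
    ring
  · simp [coeff_X_mul, sonine_coeff, Nat.choose_eq_zero_of_lt (by lia : 1 < i + 2)]

theorem sonine_recurrence (n α : ℕ) :
    C ((n + 2) * (n + 2 + α) : ℝ) * sonine (n + 2) α =
      (C (2 * n + 3 + α : ℝ) - X) * sonine (n + 1) α - sonine n α := by
  ext i
  rw [coeff_sub, sub_mul, coeff_sub, coeff_C_mul, coeff_C_mul]
  rcases i with _ | i
  · simp only [mul_coeff_zero, coeff_X_zero, sonine_coeff, Nat.factorial_succ,
      Nat.choose_zero_right]
    push_cast
    field_simp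
    ring
  · have hchoose : ((n + 1).choose i * (n + 1 - i) : ℝ) = n.choose i * (n + 1) := by
      rcases le_or_gt i (n + 1) with hi | hi
      · exact_mod_cast (Nat.choose_mul_succ_eq n i).symm
      · simp [Nat.choose_eq_zero_of_lt hi, Nat.choose_eq_zero_of_lt (by lia : n < i)]
    rw [coeff_X_mul]
    simp only [sonine_coeff, Nat.factorial_succ, ← add_assoc, Nat.choose_succ_succ' (n + 1) i,
      Nat.choose_succ_succ' n i]
    push_cast
    field_simp
    linear_combination -(n + 2 : ℝ) * (-1) ^ i * hchoose

theorem sonine_christoffel_darboux {A : Type*} [CommRing A] [Algebra ℝ A] (n α : ℕ) (x y : A) :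
    ((n + 1).factorial * (n + 1 + α).factorial : A) *
        (aeval x (sonine (n + 1) α) * aeval y (sonine n α) -
          aeval x (sonine n α) * aeval y (sonine (n + 1) α)) =
      (y - x) * ∑ k ∈ Finset.range (n + 1), (k.factorial * (k + α).factorial : A) *
        (aeval x (sonine k α) * aeval y (sonine k α)) := by
  induction n with
  | zero =>
    have hx := congrArg (aeval x) (sonine_one α)
    have hy := congrArg (aeval y) (sonine_one α)
    simp only [map_mul, map_sub, map_add, map_one, map_natCast, aeval_X] at hx hy
    simp only [Finset.sum_range_one, zero_add, Nat.factorial_zero,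
      add_comm 1 α, Nat.factorial_succ]
    push_cast
    linear_combination (α.factorial : A) * (aeval y (sonine 0 α) * hx - aeval x (sonine 0 α) * hy)
  | succ n ih =>
    have hx := congrArg (aeval x) (sonine_recurrence n α)
    have hy := congrArg (aeval y) (sonine_recurrence n α)
    simp only [map_mul, map_sub, map_add, map_natCast, map_ofNat, aeval_X] at hx hy
    rw [Finset.sum_range_succ, mul_add, ← ih, add_right_comm n 1 α, Nat.factorial_succ (n + 1),
      show n + 1 + 1 + α = n + α + 1 + 1 by ring, Nat.factorial_succ (n + α + 1)]
    push_cast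
    linear_combination ((n + 1).factorial * (n + α + 1).factorial : A) *
      (aeval y (sonine (n + 1) α) * hx - aeval x (sonine (n + 1) α) * hy)

theorem conj_eq_of_aeval_sonine_eq_zero {d α : ℕ} {z : ℂ} (hz : aeval z (sonine d α) = 0) :
    conj z = z := by
  rcases d with _ | n
  · simp [sonine_zero, Nat.factorial_ne_zero] at hz
  · have h := sonine_christoffel_darboux n α z (conj z)
    simp only [aeval_conj, hz, map_zero, mul_zero, zero_mul, sub_zero, Complex.mul_conj] at h
    refine sub_eq_zero.1 ((mul_eq_zero.1 h.symm).resolve_right ?_)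
    have hpos : 0 < ∑ k ∈ Finset.range (n + 1), (k.factorial * (k + α).factorial : ℝ) *
        Complex.normSq (aeval z (sonine k α)) :=
      Finset.sum_pos' (fun k _ => mul_nonneg (by positivity) (Complex.normSq_nonneg _))
        ⟨0, by simp, by simp [sonine_zero, Nat.factorial_pos]⟩
    exact_mod_cast hpos.ne'

theorem sonine_splits (d α : ℕ) : (sonine d α).Splits :=
  (IsAlgClosed.splits _).of_splits_map (algebraMap ℝ ℂ) fun z hz =>
    ⟨z.re, Complex.conj_eq_iff_re.1
      (conj_eq_of_aeval_sonine_eq_zero (mem_aroots.1 hz).2)⟩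

theorem sonine_separable (d α : ℕ) : (sonine d α).Separable := by
  rcases d with _ | n
  · rw [sonine_zero]
    exact (separable_C _).2 (isUnit_iff_ne_zero.2 (by positivity))
  have hne : sonine (n + 1) α ≠ 0 :=
    ne_zero_of_natDegree_gt (n := 0) (by simp [sonine_natDegree])
  rw [← nodup_roots_iff_of_splits hne (sonine_splits _ _), Multiset.nodup_iff_count_le_one]
  intro y
  by_contra! hy
  rw [count_roots, one_lt_rootMultiplicity_iff_isRoot hne] at hy
  obtain ⟨hroot, hroot'⟩ := hy
  -- The confluent Christoffel–Darboux identity makes a sum of squares vanish at a double zero.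
  have h := congrArg (fun p => (derivative p).eval y) (sonine_christoffel_darboux n α X (C y))
  rw [IsRoot] at hroot hroot'
  have haeval (p : ℝ[X]) : aeval (C y) p = C (p.eval y) :=
    aeval_algebraMap_apply_eq_algebraMap_eval y p
  simp only [haeval, aeval_X_left_apply, ← Nat.cast_mul, hroot, hroot', map_zero, mul_zero,
    sub_zero, derivative_mul, derivative_natCast, zero_mul, derivative_C, add_zero, zero_add,
    eval_mul, eval_natCast, eval_C, derivative_sub, derivative_X, zero_sub, neg_mul, one_mul,
    map_sum, eval_add, eval_neg, eval_finsetSum, eval_sub, eval_X, sub_self, zero_eq_neg] at h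
  have hpos : 0 < ∑ k ∈ Finset.range (n + 1), (k.factorial * (k + α).factorial : ℝ) *
      ((sonine k α).eval y * (sonine k α).eval y) :=
    Finset.sum_pos' (fun k _ => mul_nonneg (by positivity) (mul_self_nonneg _))
      ⟨0, by simp, by simp [sonine_zero, Nat.factorial_pos]⟩
  exact hpos.ne' (by exact_mod_cast h)

theorem sonine_eval_pos (d α : ℕ) {x : ℝ} (hx : x ≤ 0) : 0 < (sonine d α).eval x := by
  have hterm : ∀ i, (sonine d α).coeff i * x ^ i =
      d.choose i / (d.factorial * (α + i).factorial) * (-x) ^ i := fun i => by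
    rw [sonine_coeff, neg_pow x]
    ring
  have hx' : 0 ≤ -x := neg_nonneg.2 hx
  rw [eval_eq_sum_range, sonine_natDegree]
  simp only [hterm]
  exact Finset.sum_pos' (fun i _ => by positivity) ⟨0, by simp, by
    simp only [Nat.choose_zero_right, Nat.cast_one, add_zero, pow_zero, mul_one]; positivity⟩

theorem ncard_sonine_roots (d α : ℕ) : {E : ℝ | (sonine d α).eval (2 * E) = 0}.ncard = d := by
  have hroots : {E : ℝ | (sonine d α).eval (2 * E) = 0} = (2 * ·) ⁻¹' (sonine d α).rootSet ℝ := by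
    ext E
    simp [mem_rootSet, (sonine_separable d α).ne_zero]
  rw [hroots, Set.ncard_preimage_of_injective_subset_range (mul_right_injective₀ two_ne_zero)
    fun x _ => ⟨x / 2, mul_div_cancel₀ x two_ne_zero⟩, ← Nat.card_coe_set_eq,
    Nat.card_eq_fintype_card, card_rootSet_eq_natDegree (sonine_separable d α)
    ((sonine_splits d α).map _), sonine_natDegree]

end Laguerre

open MvPolynomial

/-- The complex analogue of `IsSU3Generators`, without Hermiticity: `T` is a basis of `𝔰𝔩₃(ℂ)` that
is orthogonal for the bilinear form `tr (X Y)`, with the usual normalization. -/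
def IsSL3Generators (T : Fin 8 → Matrix (Fin 3) (Fin 3) ℂ) : Prop :=
  (∀ A, (T A).trace = 0) ∧ ∀ A B, (T A * T B).trace = if A = B then 1 / 2 else 0

section Coordinates

variable {R S : Type*} [CommRing R] [Algebra ℂ R] [CommRing S] [Algebra ℂ S]
  {T : Fin 8 → Matrix (Fin 3) (Fin 3) ℂ}

/-- The coordinates `2 tr(T^A Y)` of the traceless part of a matrix `Y` with respect to the
generators. The entries may lie in any commutative `ℂ`-algebra, so that matrices of polynomials
are covered. -/
noncomputable def coord (T : Fin 8 → Matrix (Fin 3) (Fin 3) ℂ) :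
    Matrix (Fin 3) (Fin 3) R →ₗ[R] Fin 8 → R where
  toFun Y A := 2 * ((T A).map (algebraMap ℂ R) * Y).trace
  map_add' Y Z := by ext; simp [mul_add]
  map_smul' s Y := by ext; simp [mul_left_comm]

/-- The matrix `∑ x_A T^A` with given coordinates. -/
noncomputable def matrixOf (T : Fin 8 → Matrix (Fin 3) (Fin 3) ℂ) :
    (Fin 8 → R) →ₗ[R] Matrix (Fin 3) (Fin 3) R :=
  Fintype.linearCombination R fun A => (T A).map (algebraMap ℂ R)

theorem coord_apply (Y : Matrix (Fin 3) (Fin 3) R) (A : Fin 8) :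
    coord T Y A = 2 * ((T A).map (algebraMap ℂ R) * Y).trace :=
  rfl

theorem matrixOf_eq_sum (x : Fin 8 → R) :
    matrixOf T x = ∑ A, x A • (T A).map (algebraMap ℂ R) :=
  Fintype.linearCombination_apply R _ x

theorem map_coord (f : R →ₐ[ℂ] S) (Y : Matrix (Fin 3) (Fin 3) R) (A : Fin 8) :
    f (coord T Y A) = coord T (Y.map f) A := by
  simp [coord_apply, Matrix.trace, Matrix.mul_apply, map_ofNat f 2]

theorem matrixOf_map (f : R →ₐ[ℂ] S) (x : Fin 8 → R) :
    (matrixOf T x).map f = matrixOf T fun A => f (x A) := by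
  ext i j
  simp [matrixOf_eq_sum, Matrix.sum_apply]

theorem trace_map_generator (hT : IsSL3Generators T) (A : Fin 8) :
    ((T A).map (algebraMap ℂ R)).trace = 0 := by
  rw [← AddMonoidHom.map_trace, hT.1, map_zero]

theorem trace_matrixOf (hT : IsSL3Generators T) (x : Fin 8 → R) : (matrixOf T x).trace = 0 := by
  simp [matrixOf_eq_sum, Matrix.trace_sum, trace_map_generator hT]

theorem coord_one (hT : IsSL3Generators T) : coord T (1 : Matrix (Fin 3) (Fin 3) R) = 0 := by
  ext A
  simp [coord_apply, trace_map_generator hT]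

theorem coord_matrixOf (hT : IsSL3Generators T) (x : Fin 8 → R) : coord T (matrixOf T x) = x := by
  ext A
  have hAB : ∀ B, ((T A).map (algebraMap ℂ R) * (T B).map (algebraMap ℂ R)).trace =
      if A = B then algebraMap ℂ R (1 / 2) else 0 := fun B => by
    rw [← Matrix.map_mul, ← AddMonoidHom.map_trace, hT.2]
    split_ifs <;> simp
  have htwo : (2 : R) * algebraMap ℂ R (1 / 2) = 1 := by
    rw [← map_ofNat (algebraMap ℂ R) 2, ← map_mul]
    norm_num
  simp only [coord_apply, matrixOf_eq_sum, Matrix.mul_sum, Matrix.trace_sum, Matrix.mul_smul,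
    Matrix.trace_smul, hAB, smul_eq_mul, mul_ite, mul_zero, Finset.sum_ite_eq, Finset.mem_univ,
    if_true]
  rw [mul_left_comm, htwo, mul_one]

/-- The eight coordinates together with the trace are a surjection between free modules of the
same rank, hence a bijection. -/
theorem matrixOf_coord_add (hT : IsSL3Generators T) (Y : Matrix (Fin 3) (Fin 3) R) :
    matrixOf T (coord T Y) + ((1 / 3 : ℂ) • Y.trace) • (1 : Matrix (Fin 3) (Fin 3) R) = Y := by
  nontriviality R
  let Φ := (coord T).prod (Matrix.traceLinearMap (Fin 3) R R)
  have hΦ : ∀ v, Φ (matrixOf T v.1 + ((1 / 3 : ℂ) • v.2) • 1) = v := fun v => by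
    have hthree : (3 : ℂ)⁻¹ • (v.2 * 3) = v.2 := by
      rw [mul_comm, show (3 : R) * v.2 = (3 : ℂ) • v.2 by
        rw [Algebra.smul_def, map_ofNat],
        inv_smul_smul₀ three_ne_zero]
    ext <;> simp [Φ, trace_matrixOf hT, coord_one hT, coord_matrixOf hT, hthree]
  let e := LinearEquiv.ofFinrankEq (R := R) (Matrix (Fin 3) (Fin 3) R) ((Fin 8 → R) × R)
    (by simp [Module.finrank_matrix])
  have hinj : Function.Injective Φ :=
    OrzechProperty.injective_of_surjective_of_injective e.toLinearMap Φ e.injective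
      fun v => ⟨_, hΦ v⟩
  exact hinj (hΦ (Φ Y))

theorem matrixOf_coord (hT : IsSL3Generators T) {Y : Matrix (Fin 3) (Fin 3) R}
    (hY : Y.trace = 0) : matrixOf T (coord T Y) = Y := by
  simpa [hY] using matrixOf_coord_add hT Y

theorem sum_generator_mul_self (hT : IsSL3Generators T) :
    ∑ A, T A * T A = (4 / 3 : ℂ) • (1 : Matrix (Fin 3) (Fin 3) ℂ) := by
  have hFierz : ∀ i j l : Fin 3, 2 * ∑ A, T A i j * T A j l =
      (1 : Matrix (Fin 3) (Fin 3) ℂ) i l -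
        1 / 3 * ((1 : Matrix (Fin 3) (Fin 3) ℂ) i j * (1 : Matrix (Fin 3) (Fin 3) ℂ) j l) := by
    intro i j l
    have h := congrFun₂ (matrixOf_coord_add hT (Matrix.single l j (1 : ℂ))) i j
    have htrace : (Matrix.single l j (1 : ℂ)).trace = (1 : Matrix (Fin 3) (Fin 3) ℂ) j l := by
      simp [Matrix.trace, Matrix.single_apply, Matrix.one_apply, ite_and]
    have hsingle : Matrix.single l j (1 : ℂ) i j = (1 : Matrix (Fin 3) (Fin 3) ℂ) i l := by
      simp [Matrix.single_apply, Matrix.one_apply, eq_comm]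
    simp only [matrixOf_eq_sum, coord_apply, Algebra.algebraMap_self, RingHom.coe_id, Matrix.map_id,
      Matrix.trace_mul_single, MulOpposite.op_one, one_smul, Matrix.add_apply, Matrix.sum_apply,
      Matrix.smul_apply, smul_eq_mul, htrace, hsingle] at h
    rw [Finset.mul_sum, ← h, add_sub_assoc, mul_comm (_ / _ * _), mul_left_comm, sub_self, add_zero]
    exact Finset.sum_congr rfl fun A _ => by ring
  have hone : ∀ i l, ∑ j, (1 : Matrix (Fin 3) (Fin 3) ℂ) i j * (1 : Matrix (Fin 3) (Fin 3) ℂ) j l =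
      (1 : Matrix (Fin 3) (Fin 3) ℂ) i l := fun i l => by
    rw [← Matrix.mul_apply, one_mul]
  ext i l
  have hsum := Finset.sum_congr rfl fun j (_ : j ∈ Finset.univ) => hFierz i j l
  rw [← Finset.mul_sum, Finset.sum_comm, Finset.sum_sub_distrib, ← Finset.mul_sum, hone] at hsum
  simp only [Finset.sum_const, Finset.card_univ, Fintype.card_fin, nsmul_eq_mul] at hsum
  simp only [Matrix.sum_apply, Matrix.mul_apply, Matrix.smul_apply, smul_eq_mul]
  push_cast at hsum
  linear_combination (1 / 2) * hsum

end Coordinates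

section TracePowers

variable {R A n : Type*} [CommRing R] [CommRing A] [Algebra R A] [Fintype n]
  (D : Derivation R A A)

theorem map_derivation_mul (M N : Matrix n n A) :
    (M * N).map D = M.map D * N + M * N.map D := by
  ext i j
  simp [Matrix.mul_apply, ← Finset.sum_add_distrib, mul_comm, add_comm]

theorem trace_map_derivation_pow_mul_pow [DecidableEq n] (M : Matrix n n A) (k l : ℕ) :
    ((M ^ (k + 1)).map D * M ^ l).trace = (k + 1) * (M ^ (k + l) * M.map D).trace := by
  induction k generalizing l with
  | zero => simpa using Matrix.trace_mul_comm (M.map D) (M ^ l)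
  | succ k ih =>
    rw [pow_succ, map_derivation_mul, add_mul, Matrix.trace_add, mul_assoc, ← pow_succ', ih,
      Matrix.trace_mul_comm (_ * _), ← mul_assoc, ← pow_add]
    push_cast
    ring_nf

theorem derivation_trace_pow [DecidableEq n] (M : Matrix n n A) (k : ℕ) :
    D (M ^ (k + 1)).trace = (k + 1) * (M ^ k * M.map D).trace := by
  rw [AddMonoidHom.map_trace]
  simpa using trace_map_derivation_pow_mul_pow D M k 0

end TracePowers

section ConjugationInvariance

theorem hasDerivAt_eval_of_derivation {𝕜 σ : Type*} [NontriviallyNormedField 𝕜]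
    (D : Derivation 𝕜 (MvPolynomial σ 𝕜) (MvPolynomial σ 𝕜)) {x : 𝕜 → σ → 𝕜} {s : 𝕜}
    (hx : ∀ i, HasDerivAt (fun u => x u i) (eval (x s) (D (X i))) s) (p : MvPolynomial σ 𝕜) :
    HasDerivAt (fun u => eval (x u) p) (eval (x s) (D p)) s := by
  induction p using MvPolynomial.induction_on with
  | C a => simpa using hasDerivAt_const s a
  | add p q hp hq => simpa using hp.fun_add hq
  | mul_X p i hp =>
    simp only [map_mul, eval_X]
    refine (hp.mul (hx i)).congr_deriv ?_
    simp only [Derivation.leibniz, smul_eq_mul, map_add, map_mul, eval_X]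
    ring

theorem eval_integralCurve_eq {𝕜 σ : Type*} [RCLike 𝕜]
    {D : Derivation 𝕜 (MvPolynomial σ 𝕜) (MvPolynomial σ 𝕜)} {x : 𝕜 → σ → 𝕜}
    (hx : ∀ s i, HasDerivAt (fun u => x u i) (eval (x s) (D (X i))) s) {p : MvPolynomial σ 𝕜}
    (hp : D p = 0) (s t : 𝕜) : eval (x s) p = eval (x t) p := by
  have hderiv : ∀ s, HasDerivAt (fun u => eval (x u) p) 0 s := fun s => by
    simpa [hp] using hasDerivAt_eval_of_derivation D (hx s) p
  exact is_const_of_deriv_eq_zero (fun u => (hderiv u).differentiableAt)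
    (fun u => (hderiv u).deriv) s t

theorem hasDerivAt_exp_conj {𝕂 𝔸 : Type*} [RCLike 𝕂] [NormedRing 𝔸] [NormedAlgebra 𝕂 𝔸]
    [CompleteSpace 𝔸] (Z Y : 𝔸) (s : 𝕂) :
    HasDerivAt (fun u : 𝕂 => NormedSpace.exp (u • Z) * Y * NormedSpace.exp (u • -Z))
      (Z * (NormedSpace.exp (s • Z) * Y * NormedSpace.exp (s • -Z)) -
        NormedSpace.exp (s • Z) * Y * NormedSpace.exp (s • -Z) * Z) s := by
  refine (((hasDerivAt_exp_smul_const' Z s).mul_const Y).mul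
    (hasDerivAt_exp_smul_const (-Z) s)).congr_deriv ?_
  noncomm_ring

variable {n : Type*} [Fintype n] [DecidableEq n]

open scoped Matrix.Norms.Operator in
theorem matrix_exp_of_sq_eq_zero {E : Matrix n n ℂ} (hE : E ^ 2 = 0) :
    NormedSpace.exp E = 1 + E := by
  have hzero : ∀ k ∉ Finset.range 2, ((k.factorial : ℂ)⁻¹) • E ^ k = 0 := fun k hk => by
    rw [pow_eq_zero_of_le (not_lt.1 (Finset.mem_range.not.1 hk)) hE, smul_zero]
  rw [NormedSpace.exp_eq_tsum ℂ]
  simp only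
  rw [tsum_eq_sum hzero]
  simp [Finset.sum_range_succ]

theorem exp_induction_of_det_ne_zero (P : Matrix n n ℂ → Prop) (hexp : ∀ Z, P (NormedSpace.exp Z))
    (hmul : ∀ A B, P A → P B → P (A * B)) {M : Matrix n n ℂ} (hM : M.det ≠ 0) : P M := by
  refine Matrix.diagonal_transvection_induction_of_det_ne_zero P M hM (fun d hd => ?_)
    (fun t => ?_) fun A B _ _ => hmul A B
  · rw [Matrix.det_diagonal, Finset.prod_ne_zero_iff] at hd
    have hlog : NormedSpace.exp (fun i => Complex.log (d i)) = d := by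
      ext i
      rw [Pi.coe_exp, ← Complex.exp_eq_exp_ℂ, Complex.exp_log (hd i (Finset.mem_univ i))]
    rw [← hlog, ← Matrix.exp_diagonal]
    exact hexp _
  · have hsq : Matrix.single t.i t.j t.c ^ 2 = 0 := by
      rw [sq, Matrix.single_mul_single_of_ne _ _ _ _ t.hij.symm]
    rw [Matrix.TransvectionStruct.toMatrix, Matrix.transvection, ← matrix_exp_of_sq_eq_zero hsq]
    exact hexp _

end ConjugationInvariance

section Gauge

variable {T : Fin 8 → Matrix (Fin 3) (Fin 3) ℂ}

/-- The matrix `∑ x_A T^A` of linear forms, the generic traceless matrix. -/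
noncomputable def genericMatrix (T : Fin 8 → Matrix (Fin 3) (Fin 3) ℂ) :
    Matrix (Fin 3) (Fin 3) Fock :=
  matrixOf T X

/-- The vector field `Y ↦ [Z, Y]` on traceless matrices, as a derivation of the polynomial
functions. It generates the conjugation by `exp (s Z)`. -/
noncomputable def commutatorDerivation (T : Fin 8 → Matrix (Fin 3) (Fin 3) ℂ) :
    Matrix (Fin 3) (Fin 3) ℂ →ₗ[ℂ] Derivation ℂ Fock Fock where
  toFun Z := mkDerivation ℂ (coord T (Z.map (algebraMap ℂ Fock) * genericMatrix T -
    genericMatrix T * Z.map (algebraMap ℂ Fock)))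
  map_add' Z W := derivation_ext fun A => by
    simp only [Derivation.add_apply, mkDerivation_X, Matrix.map_add _ (map_add _), add_mul, mul_add,
      map_sub, map_add, Pi.sub_apply, Pi.add_apply]
    ring
  map_smul' s Z := derivation_ext fun A => by
    simp only [RingHom.id_apply, Derivation.smul_apply, mkDerivation_X,
      Matrix.map_smul' _ _ _ (map_mul _), Matrix.smul_mul, Matrix.mul_smul, ← smul_sub]
    rw [map_smul, Pi.smul_apply, algebraMap_smul]

theorem commutatorDerivation_X (Z : Matrix (Fin 3) (Fin 3) ℂ) (A : Fin 8) :
    commutatorDerivation T Z (X A) =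
      coord T (Z.map (algebraMap ℂ Fock) * genericMatrix T -
        genericMatrix T * Z.map (algebraMap ℂ Fock)) A :=
  mkDerivation_X ℂ _ A

theorem map_commutatorDerivation_genericMatrix (hT : IsSL3Generators T)
    (Z : Matrix (Fin 3) (Fin 3) ℂ) :
    (genericMatrix T).map (commutatorDerivation T Z) =
      Z.map (algebraMap ℂ Fock) * genericMatrix T -
        genericMatrix T * Z.map (algebraMap ℂ Fock) := by
  have htrace : (Z.map (algebraMap ℂ Fock) * genericMatrix T -
      genericMatrix T * Z.map (algebraMap ℂ Fock)).trace = 0 := by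
    rw [Matrix.trace_sub, Matrix.trace_mul_comm, sub_self]
  rw [← matrixOf_coord hT htrace]
  ext1 i j
  simp only [genericMatrix, matrixOf_eq_sum, Matrix.map_apply, Matrix.sum_apply, Matrix.smul_apply,
    smul_eq_mul, map_sum, Derivation.leibniz, Derivation.map_algebraMap, mul_zero, zero_add,
    commutatorDerivation_X]
  exact Finset.sum_congr rfl fun A _ => mul_comm _ _

theorem pderiv_comm {σ R : Type*} [CommRing R] (i j : σ) (p : MvPolynomial σ R) :
    pderiv i (pderiv j p) = pderiv j (pderiv i p) := by
  classical
  have h : ⁅(pderiv i : Derivation R (MvPolynomial σ R) (MvPolynomial σ R)), pderiv j⁆ = 0 :=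
    derivation_ext fun k => by
      rw [Derivation.commutator_apply, pderiv_X, pderiv_X]
      simp only [Pi.single_apply]
      split_ifs <;> simp
  exact sub_eq_zero.1 (DFunLike.congr_fun h p)

theorem structureConst_antisymm (A B C : Fin 8) :
    structureConst T A C B = -structureConst T A B C := by
  have h1 : (T A * T C * T B).trace = (T B * T A * T C).trace := by
    rw [Matrix.trace_mul_comm, Matrix.mul_assoc]
  have h2 : (T C * T A * T B).trace = (T A * T B * T C).trace := by
    rw [Matrix.mul_assoc, Matrix.trace_mul_comm]
  simp only [structureConst, Matrix.sub_mul, Matrix.trace_sub, h1, h2]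
  ring

theorem two_smul_sum_antisymm_smul {ι R M : Type*} [Fintype ι] [CommRing R] [AddCommGroup M]
    [Module R M] {f : ι → ι → R} (hf : ∀ i j, f j i = -f i j) (F : ι → ι → M) :
    (2 : R) • ∑ i, ∑ j, f i j • F i j = ∑ i, ∑ j, f i j • (F i j - F j i) := by
  have hswap : ∑ i, ∑ j, f i j • F j i = -∑ i, ∑ j, f i j • F i j := by
    rw [Finset.sum_comm, ← Finset.sum_neg_distrib]
    refine Finset.sum_congr rfl fun i _ => ?_
    rw [← Finset.sum_neg_distrib]
    exact Finset.sum_congr rfl fun j _ => by rw [hf, neg_smul]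
  simp only [smul_sub, Finset.sum_sub_distrib, hswap]
  module

theorem fieldOp_mul_momentumOp_sub_swap (A B : Fin 8) (p : Fock) :
    (fieldOp A * momentumOp B) p - (fieldOp B * momentumOp A) p =
      (-Complex.I) • (X A * pderiv B p - X B * pderiv A p) := by
  have hsqrt : ((Real.sqrt 2 : ℝ) : ℂ)⁻¹ * (Complex.I * ((Real.sqrt 2 : ℝ) : ℂ))⁻¹ =
      -Complex.I / 2 := by
    have h2 : ((Real.sqrt 2 : ℝ) : ℂ) * ((Real.sqrt 2 : ℝ) : ℂ) = 2 := by
      rw [← Complex.ofReal_mul, Real.mul_self_sqrt zero_le_two, Complex.ofReal_ofNat]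
    rw [mul_inv, mul_left_comm, ← mul_inv, h2, Complex.inv_I, div_eq_mul_inv]
  have hhalf : (C (-Complex.I) : Fock) = 2 * C (-Complex.I / 2) := by
    rw [← map_ofNat C 2, ← C_mul]
    ring_nf
  have hδ : (pderiv A (X B) : Fock) = pderiv B (X A) := by
    simp only [pderiv_X, Pi.single_apply, eq_comm]
  simp only [fieldOp, momentumOp, smul_mul_smul_comm, hsqrt, LinearMap.smul_apply,
    Module.End.mul_apply, LinearMap.add_apply, LinearMap.sub_apply, annihilation, creation,
    LinearMap.mulLeft_apply, Derivation.coeFn_coe, map_sub, pderiv_mul, hδ, pderiv_comm A B,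
    smul_eq_C_mul, hhalf]
  ring

theorem commutatorDerivation_generator_X (A B : Fin 8) :
    commutatorDerivation T (T A) (X B) = Complex.I • ∑ C, structureConst T A C B • X C := by
  have hconst : ∀ C, 2 * ((T B).map (algebraMap ℂ Fock) *
      ((T A).map (algebraMap ℂ Fock) * (T C).map (algebraMap ℂ Fock) -
        (T C).map (algebraMap ℂ Fock) * (T A).map (algebraMap ℂ Fock))).trace =
      algebraMap ℂ Fock (Complex.I * structureConst T A C B) := fun C => by
    rw [Matrix.trace_mul_comm, ← Matrix.map_mul, ← Matrix.map_mul, ← Matrix.map_sub _ (map_sub _),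
      ← Matrix.map_mul, ← AddMonoidHom.map_trace, ← map_ofNat (algebraMap ℂ Fock) 2, ← map_mul,
      structureConst]
    congr 1
    linear_combination (2 * ((T A * T C - T C * T A) * T B).trace) * Complex.I_sq
  rw [commutatorDerivation_X, genericMatrix, matrixOf_eq_sum, Finset.mul_sum, Finset.sum_mul,
    ← Finset.sum_sub_distrib, map_sum, Finset.sum_apply, Finset.smul_sum]
  refine Finset.sum_congr rfl fun C _ => ?_
  rw [Matrix.mul_smul, Matrix.smul_mul, ← smul_sub, map_smul, Pi.smul_apply, coord_apply, hconst,
    smul_eq_mul, smul_smul, Algebra.smul_def, mul_comm]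

theorem derivation_sum_apply {ι R A M : Type*} [CommSemiring R] [CommSemiring A] [Algebra R A]
    [AddCommMonoid M] [Module R M] [Module A M] (s : Finset ι) (D : ι → Derivation R A M) (a : A) :
    (∑ i ∈ s, D i) a = ∑ i ∈ s, D i a := by
  rw [← Finset.sum_apply a s fun i => ⇑(D i)]
  exact congrFun (map_sum Derivation.coeFnAddMonoidHom D s) a

theorem derivation_apply_eq_sum {σ R : Type*} [Fintype σ] [CommSemiring R]
    (D : Derivation R (MvPolynomial σ R) (MvPolynomial σ R)) (p : MvPolynomial σ R) :
    D p = ∑ i, D (X i) * pderiv i p := by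
  classical
  have hD : D = ∑ i, D (X i) • pderiv i := derivation_ext fun j => by
    simp [derivation_sum_apply, pderiv_X, Pi.single_apply]
  conv_lhs => rw [hD]
  simp [derivation_sum_apply]

theorem commutatorDerivation_generator_apply (A : Fin 8) (p : Fock) :
    commutatorDerivation T (T A) p =
      Complex.I • ∑ B, ∑ C, structureConst T A B C • (X B * pderiv C p) := by
  rw [derivation_apply_eq_sum, Finset.sum_comm]
  simp only [commutatorDerivation_generator_X, Finset.smul_sum, Finset.sum_mul, smul_mul_assoc]

theorem gaugeGenerator_apply (A : Fin 8) (p : Fock) :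
    gaugeGenerator T A p = -commutatorDerivation T (T A) p := by
  apply smul_right_injective Fock (two_ne_zero (α := ℂ))
  calc (2 : ℂ) • gaugeGenerator T A p
      = ∑ B, ∑ C, structureConst T A B C •
          ((fieldOp B * momentumOp C) p - (fieldOp C * momentumOp B) p) := by
        simp only [gaugeGenerator, LinearMap.sum_apply, LinearMap.smul_apply]
        exact two_smul_sum_antisymm_smul (structureConst_antisymm A) _
    _ = -Complex.I • ∑ B, ∑ C, structureConst T A B C •
          (X B * pderiv C p - X C * pderiv B p) := by
        simp only [fieldOp_mul_momentumOp_sub_swap, Finset.smul_sum, smul_comm (-Complex.I)]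
    _ = (2 : ℂ) • -commutatorDerivation T (T A) p := by
        rw [← two_smul_sum_antisymm_smul (structureConst_antisymm A),
          commutatorDerivation_generator_apply, neg_smul, smul_neg, smul_comm]

theorem commutatorDerivation_apply_eq_zero (hT : IsSL3Generators T) {p : Fock}
    (hp : ∀ A, gaugeGenerator T A p = 0) (Z : Matrix (Fin 3) (Fin 3) ℂ) :
    commutatorDerivation T Z p = 0 := by
  have hgen : ∀ A, commutatorDerivation T (T A) p = 0 := fun A => by
    rw [← neg_eq_zero, ← gaugeGenerator_apply, hp]
  have hone : commutatorDerivation T 1 = 0 := derivation_ext fun A => by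
    rw [commutatorDerivation_X, Matrix.map_one _ (map_zero _) (map_one _), one_mul, mul_one,
      sub_self, map_zero]
    rfl
  rw [← matrixOf_coord_add hT Z, matrixOf_eq_sum]
  simp [hgen, hone, derivation_sum_apply]

theorem genericMatrix_map_aeval {R : Type*} [CommRing R] [Algebra ℂ R] (x : Fin 8 → R) :
    (genericMatrix T).map (aeval x) = matrixOf T x := by
  simp [genericMatrix, matrixOf_map]

theorem eval_commutatorDerivation_X (hT : IsSL3Generators T) (Z Y : Matrix (Fin 3) (Fin 3) ℂ)
    (A : Fin 8) :
    eval (coord T Y) (commutatorDerivation T Z (X A)) = coord T (Z * Y - Y * Z) A := by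
  have hZ : (Z.map (algebraMap ℂ Fock)).map (aeval (coord T Y)) = Z := by
    ext
    simp
  have hY : Z * matrixOf T (coord T Y) - matrixOf T (coord T Y) * Z = Z * Y - Y * Z := by
    conv_rhs => rw [← matrixOf_coord_add hT Y]
    simp [mul_add, add_mul]
  rw [commutatorDerivation_X, ← coe_aeval_eq_eval, RingHom.coe_coe, map_coord,
    Matrix.map_sub _ (map_sub _), Matrix.map_mul, Matrix.map_mul, hZ, genericMatrix_map_aeval, hY]

open scoped Matrix.Norms.Operator in
theorem eval_coord_exp_conj (hT : IsSL3Generators T) {p : Fock}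
    (hp : ∀ A, gaugeGenerator T A p = 0) (Z Y : Matrix (Fin 3) (Fin 3) ℂ) :
    eval (coord T (NormedSpace.exp Z * Y * (NormedSpace.exp Z)⁻¹)) p = eval (coord T Y) p := by
  have hcurve : ∀ s A, HasDerivAt
      (fun u : ℂ => coord T (NormedSpace.exp (u • Z) * Y * NormedSpace.exp (u • -Z)) A)
      (eval (coord T (NormedSpace.exp (s • Z) * Y * NormedSpace.exp (s • -Z)))
        (commutatorDerivation T Z (X A))) s := fun s A => by
    rw [eval_commutatorDerivation_X hT]
    exact ((LinearMap.proj A ∘ₗ coord T).toContinuousLinearMap.hasFDerivAt).comp_hasDerivAt s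
      (hasDerivAt_exp_conj Z Y s)
  simpa [Matrix.exp_neg] using
    eval_integralCurve_eq hcurve (commutatorDerivation_apply_eq_zero hT hp Z) 1 0

theorem eval_coord_conj (hT : IsSL3Generators T) {p : Fock}
    (hp : ∀ A, gaugeGenerator T A p = 0) {g : Matrix (Fin 3) (Fin 3) ℂ} (hg : g.det ≠ 0)
    (Y : Matrix (Fin 3) (Fin 3) ℂ) :
    eval (coord T (g * Y * g⁻¹)) p = eval (coord T Y) p := by
  revert Y
  refine exp_induction_of_det_ne_zero (fun g => ∀ Y, eval (coord T (g * Y * g⁻¹)) p =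
    eval (coord T Y) p) (fun Z => eval_coord_exp_conj hT hp Z) (fun A B hA hB Y => ?_) hg
  rw [Matrix.mul_inv_rev, ← hB Y, ← hA (B * Y * B⁻¹)]
  simp only [mul_assoc]

end Gauge

section Companion

variable {R S : Type*} [CommRing R] [CommRing S]

/-- The companion matrix of `X³ - pX - q`. The matrices `slice p q` meet almost every conjugacy
class of traceless matrices exactly once. -/
def slice (p q : R) : Matrix (Fin 3) (Fin 3) R :=
  !![0, 0, q; 1, 0, p; 0, 1, 0]

/-- The matrix with columns `e, Ye, Y²e` for the first basis vector `e`. It conjugates `Y` to a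
companion matrix. -/
def krylov (Y : Matrix (Fin 3) (Fin 3) R) : Matrix (Fin 3) (Fin 3) R :=
  Matrix.of fun i j => (Y ^ (j : ℕ)) i 0

theorem trace_slice (p q : R) : (slice p q).trace = 0 := by
  simp [slice, Matrix.trace_fin_three]

theorem trace_slice_sq (p q : R) : (slice p q ^ 2).trace = 2 * p := by
  simp [slice, sq, Matrix.trace_fin_three, two_mul]

theorem trace_slice_cube (p q : R) : (slice p q ^ 3).trace = 3 * q := by
  simp [slice, pow_succ, Matrix.trace_fin_three]
  ring

theorem slice_map {F : Type*} [FunLike F R S] [RingHomClass F R S] (f : F) (p q : R) :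
    (slice p q).map f = slice (f p) (f q) := by
  ext i j
  fin_cases i <;> fin_cases j <;> simp [slice]

theorem krylov_map (f : R →+* S) (Y : Matrix (Fin 3) (Fin 3) R) :
    krylov (Y.map f) = (krylov Y).map f := by
  ext i j
  simp [krylov, ← Matrix.map_pow]

theorem det_krylov_slice (p q : R) : (krylov (slice p q)).det = 1 := by
  simp [krylov, slice, Matrix.det_fin_three, pow_succ]

theorem mul_krylov {Y : Matrix (Fin 3) (Fin 3) R} {p q : R} (hY : Y ^ 3 = p • Y + q • 1) :
    Y * krylov Y = krylov Y * slice p q := by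
  have hmul : ∀ i j, (Y * krylov Y) i j = (Y ^ ((j : ℕ) + 1)) i 0 := fun i j => by
    simp [krylov, pow_succ', Matrix.mul_apply]
  ext i j
  rw [hmul]
  fin_cases j <;> simp [krylov, slice, Matrix.mul_apply, Fin.sum_univ_three, hY]
  ring

variable [Algebra ℂ R]

theorem pow_three_of_trace_eq_zero {Y : Matrix (Fin 3) (Fin 3) R} (hY : Y.trace = 0) :
    Y ^ 3 = ((1 / 2 : ℂ) • (Y ^ 2).trace) • Y + ((1 / 3 : ℂ) • (Y ^ 3).trace) • 1 := by
  have hY' : Y 2 2 = -Y 0 0 - Y 1 1 := by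
    rw [Matrix.trace_fin_three] at hY
    linear_combination hY
  have hsix : (6 : ℂ) • Y ^ 3 =
      (3 : ℂ) • ((Y ^ 2).trace • Y) + (2 : ℂ) • ((Y ^ 3).trace • 1) := by
    ext i j
    fin_cases i <;> fin_cases j <;>
      simp [Matrix.mul_apply, Fin.sum_univ_three, pow_succ, Matrix.trace_fin_three, hY',
        Algebra.smul_def (A := R), map_ofNat (algebraMap ℂ R)] <;> ring
  rw [smul_assoc, smul_assoc]
  refine (inv_smul_smul₀ (by norm_num : (6 : ℂ) ≠ 0) (Y ^ 3)).symm.trans ?_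
  rw [hsix, smul_add, smul_smul, smul_smul]
  norm_num

theorem trace_pow_four {Y : Matrix (Fin 3) (Fin 3) R} (hY : Y.trace = 0) :
    (Y ^ 4).trace = (1 / 2 : ℂ) • (Y ^ 2).trace ^ 2 := by
  rw [pow_succ, pow_three_of_trace_eq_zero hY]
  simp [add_mul, ← sq, hY]

end Companion

section Invariants

variable {T : Fin 8 → Matrix (Fin 3) (Fin 3) ℂ}

/-- The invariant `tr((a†)^k)`, as a polynomial in the creation operators. -/
noncomputable def powerTrace (T : Fin 8 → Matrix (Fin 3) (Fin 3) ℂ) (k : ℕ) : Fock :=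
  (genericMatrix T ^ k).trace

theorem creationMatrix_eq :
    creationMatrix T = (genericMatrix T).map (Algebra.lmul ℂ Fock) := by
  ext1 i j
  refine LinearMap.ext fun p => ?_
  simp [creationMatrix, genericMatrix, matrixOf_eq_sum, Matrix.sum_apply, creation,
    smul_eq_C_mul, mul_left_comm, mul_assoc]

theorem trace_creationMatrix_pow (k : ℕ) :
    (creationMatrix T ^ k).trace = Algebra.lmul ℂ Fock (powerTrace T k) := by
  rw [creationMatrix_eq, ← AlgHom.mapMatrix_apply, ← map_pow, AlgHom.mapMatrix_apply, powerTrace,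
    AddMonoidHom.map_trace]

theorem brickState_eq (j k : ℕ) :
    brickState T j k = powerTrace T 2 ^ j * powerTrace T 3 ^ k := by
  rw [brickState, ← sq, ← pow_succ, trace_creationMatrix_pow, trace_creationMatrix_pow,
    ← map_pow, ← map_pow, ← map_mul, Algebra.coe_lmul_eq_mul, LinearMap.mul_apply', mul_one]

theorem genericMatrix_pow_isHomogeneous (k : ℕ) (i j : Fin 3) :
    ((genericMatrix T ^ k) i j).IsHomogeneous k := by
  induction k generalizing i j with
  | zero =>
    rw [pow_zero, Matrix.one_apply]
    split_ifs
    · exact isHomogeneous_one _ _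
    · exact isHomogeneous_zero _ _ _
  | succ k ih =>
    rw [pow_succ, Matrix.mul_apply]
    refine IsHomogeneous.sum _ _ _ fun l _ => (ih i l).mul ?_
    rw [genericMatrix, matrixOf_eq_sum, Matrix.sum_apply]
    exact IsHomogeneous.sum _ _ _ fun A _ =>
      (isHomogeneous_X ℂ A).mul (isHomogeneous_C _ _)

theorem powerTrace_isHomogeneous (k : ℕ) : (powerTrace T k).IsHomogeneous k :=
  IsHomogeneous.sum _ _ _ fun i _ => genericMatrix_pow_isHomogeneous k i i

theorem brickState_isHomogeneous (j k : ℕ) : (brickState T j k).IsHomogeneous (2 * j + 3 * k) := by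
  rw [brickState_eq]
  exact ((powerTrace_isHomogeneous 2).pow j).mul ((powerTrace_isHomogeneous 3).pow k)

theorem commutatorDerivation_powerTrace (hT : IsSL3Generators T) (Z : Matrix (Fin 3) (Fin 3) ℂ)
    (k : ℕ) : commutatorDerivation T Z (powerTrace T k) = 0 := by
  cases k with
  | zero => simp [powerTrace, ← map_ofNat (algebraMap ℂ Fock) 3, -algebraMap_eq]
  | succ k =>
    rw [powerTrace, derivation_trace_pow, map_commutatorDerivation_genericMatrix hT, mul_sub,
      Matrix.trace_sub, ← mul_assoc, Matrix.trace_mul_cycle, ← mul_assoc, ← pow_succ, ← pow_succ',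
      sub_self, mul_zero]

theorem gaugeGenerator_brickState (hT : IsSL3Generators T) (A : Fin 8) (j k : ℕ) :
    gaugeGenerator T A (brickState T j k) = 0 := by
  simp [gaugeGenerator_apply, brickState_eq, Derivation.leibniz_pow,
    commutatorDerivation_powerTrace hT]

/-- Restriction of polynomials on the traceless matrices to the companion matrices. -/
noncomputable def restrictSlice (T : Fin 8 → Matrix (Fin 3) (Fin 3) ℂ) :
    Fock →ₐ[ℂ] MvPolynomial (Fin 2) ℂ :=
  aeval (coord T (slice (X 0) (X 1)))

/-- The polynomial in the two invariants that restricts to a given one on companion matrices. -/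
noncomputable def extendSlice (T : Fin 8 → Matrix (Fin 3) (Fin 3) ℂ) :
    MvPolynomial (Fin 2) ℂ →ₐ[ℂ] Fock :=
  aeval ![(1 / 2 : ℂ) • powerTrace T 2, (1 / 3 : ℂ) • powerTrace T 3]

theorem aeval_powerTrace {R : Type*} [CommRing R] [Algebra ℂ R] (x : Fin 8 → R) (k : ℕ) :
    aeval x (powerTrace T k) = (matrixOf T x ^ k).trace := by
  rw [← genericMatrix_map_aeval, ← AlgHom.mapMatrix_apply, ← map_pow, AlgHom.mapMatrix_apply,
    powerTrace, AddMonoidHom.map_trace]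

theorem restrictSlice_powerTrace (hT : IsSL3Generators T) (k : ℕ) :
    restrictSlice T (powerTrace T k) = (slice (X 0) (X 1) ^ k).trace := by
  rw [restrictSlice, aeval_powerTrace, matrixOf_coord hT (trace_slice _ _)]

theorem eval_extendSlice_restrictSlice (x : Fin 8 → ℂ) (P : Fock) :
    eval x (extendSlice T (restrictSlice T P)) =
      eval (coord T (slice ((1 / 2 : ℂ) • (matrixOf T x ^ 2).trace)
        ((1 / 3 : ℂ) • (matrixOf T x ^ 3).trace))) P := by
  have h : (aeval x).comp ((extendSlice T).comp (restrictSlice T)) =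
      aeval (coord T (slice ((1 / 2 : ℂ) • (matrixOf T x ^ 2).trace)
        ((1 / 3 : ℂ) • (matrixOf T x ^ 3).trace))) := by
    ext A
    rw [AlgHom.comp_apply, AlgHom.comp_apply, restrictSlice, aeval_X, map_coord, map_coord,
      slice_map, slice_map, aeval_X]
    simp [extendSlice, ← aeval_powerTrace]
  exact DFunLike.congr_fun h P

theorem det_krylov_genericMatrix_ne_zero (hT : IsSL3Generators T) :
    (krylov (genericMatrix T)).det ≠ 0 := fun h => by
  have h1 := congrArg (eval (coord T (slice (0 : ℂ) 0))) h
  rw [RingHom.map_det, RingHom.mapMatrix_apply, ← krylov_map, ← coe_aeval_eq_eval, RingHom.coe_coe,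
    genericMatrix_map_aeval, matrixOf_coord hT (trace_slice _ _), det_krylov_slice, map_zero] at h1
  exact one_ne_zero h1

theorem eval_extendSlice_restrictSlice_of_det_ne_zero (hT : IsSL3Generators T) {P : Fock}
    (hP : ∀ A, gaugeGenerator T A P = 0) {x : Fin 8 → ℂ} (hx : (krylov (matrixOf T x)).det ≠ 0) :
    eval x (extendSlice T (restrictSlice T P)) = eval x P := by
  rw [eval_extendSlice_restrictSlice, ← eval_coord_conj hT hP hx,
    ← mul_krylov (pow_three_of_trace_eq_zero (trace_matrixOf hT x)),
    Matrix.mul_nonsing_inv_cancel_right _ _ hx.isUnit, coord_matrixOf hT]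

/-- The gauge invariant `P` agrees with a polynomial in the two invariants at all matrices
conjugate to a companion matrix, that is, outside of the zeros of a nonzero polynomial. -/
theorem extendSlice_restrictSlice (hT : IsSL3Generators T) {P : Fock}
    (hP : ∀ A, gaugeGenerator T A P = 0) : extendSlice T (restrictSlice T P) = P := by
  refine mul_right_cancel₀ (det_krylov_genericMatrix_ne_zero hT) (MvPolynomial.funext fun x => ?_)
  rw [map_mul, map_mul, RingHom.map_det, RingHom.mapMatrix_apply, ← krylov_map,
    ← coe_aeval_eq_eval, RingHom.coe_coe, genericMatrix_map_aeval]
  by_cases hx : (krylov (matrixOf T x)).det = 0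
  · rw [hx, mul_zero, mul_zero]
  · exact congrArg (· * _) (eval_extendSlice_restrictSlice_of_det_ne_zero hT hP hx)

/-- They restrict to nonzero multiples of distinct monomials on the companion matrices. -/
theorem linearIndependent_brickState (hT : IsSL3Generators T) :
    LinearIndependent ℂ fun p : ℕ × ℕ => brickState T p.1 p.2 := by
  refine LinearIndependent.of_comp (restrictSlice T).toLinearMap ?_
  let exponent : ℕ × ℕ → Fin 2 →₀ ℕ := fun p => Finsupp.single 0 p.1 + Finsupp.single 1 p.2
  have hinj : Function.Injective exponent := fun p q h =>
    Prod.ext (by simpa [exponent] using DFunLike.congr_fun h 0)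
      (by simpa [exponent] using DFunLike.congr_fun h 1)
  let coeff : ℕ × ℕ → ℂˣ := fun p => Units.mk0 ((2 : ℂ) ^ p.1 * 3 ^ p.2) (by simp)
  have hmonomials : LinearIndependent ℂ (coeff • (basisMonomials (Fin 2) ℂ ∘ exponent)) :=
    ((basisMonomials (Fin 2) ℂ).linearIndependent.comp exponent hinj).units_smul coeff
  suffices h : (restrictSlice T).toLinearMap ∘ (fun p : ℕ × ℕ => brickState T p.1 p.2) =
      coeff • (basisMonomials (Fin 2) ℂ ∘ exponent) by rwa [h]
  funext p
  simp only [Function.comp_apply, AlgHom.toLinearMap_apply, brickState_eq, map_mul, map_pow,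
    restrictSlice_powerTrace hT, trace_slice_sq, trace_slice_cube, coe_basisMonomials,
    Pi.smul_apply', exponent, coeff, Units.smul_mk0, smul_eq_C_mul, mul_pow, monomial_add_single,
    ← C_mul_X_pow_eq_monomial, C_1, one_mul, map_ofNat]
  ring

theorem extendSlice_mem_span (Q : MvPolynomial (Fin 2) ℂ) : extendSlice T Q ∈
    Submodule.span ℂ (Set.range fun p : ℕ × ℕ => brickState T p.1 p.2) := by
  induction Q using MvPolynomial.induction_on' with
  | monomial u a =>
    have hmonomial : extendSlice T (monomial u a) =
        (a * ((1 / 2) ^ u 0 * (1 / 3) ^ u 1)) • brickState T (u 0) (u 1) := by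
      rw [extendSlice, aeval_monomial, brickState_eq, Finsupp.prod_fintype _ _ (by simp),
        Fin.prod_univ_two, ← Algebra.smul_def, Matrix.cons_val_zero, Matrix.cons_val_one,
        Matrix.cons_val_fin_one, smul_pow, smul_pow, smul_mul_smul_comm, smul_smul]
    rw [hmonomial]
    exact Submodule.smul_mem _ _ (Submodule.subset_span ⟨(u 0, u 1), rfl⟩)
  | add p q hp hq => simpa only [map_add] using Submodule.add_mem _ hp hq

end Invariants

section CutSpace

variable {T : Fin 8 → Matrix (Fin 3) (Fin 3) ℂ} {N : ℕ}

theorem cutProjection_of_isHomogeneous (N : ℕ) {m : ℕ} {p : Fock} (hp : p.IsHomogeneous m) :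
    cutProjection N p = if m ≤ N then p else 0 := by
  simp only [cutProjection, LinearMap.sum_apply]
  rw [Finset.sum_congr rfl fun n _ => homogeneousComponent_of_mem (n := m) (m := n) hp]
  simp [Finset.sum_ite_eq']

theorem cutProjection_of_totalDegree_le {p : Fock} (hp : p.totalDegree ≤ N) :
    cutProjection N p = p := by
  simp only [cutProjection, LinearMap.sum_apply]
  refine Eq.trans (Eq.symm ?_) (sum_homogeneousComponent p)
  refine Finset.sum_subset (Finset.range_mono (by lia)) fun n _ hn =>
    homogeneousComponent_eq_zero _ _ ?_
  rw [Finset.mem_range] at hn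
  lia

theorem mem_brickIndices {p : ℕ × ℕ} : p ∈ brickIndices N ↔ 2 * p.1 + 3 * p.2 ≤ N := by
  simp only [brickIndices, Finset.mem_filter, Finset.mem_product, Finset.mem_range]
  lia

theorem mem_cutSpace {p : Fock} :
    p ∈ cutSpace T N ↔ (∀ A, gaugeGenerator T A p = 0) ∧ p.totalDegree ≤ N := by
  simp [cutSpace, Submodule.mem_iInf, mem_restrictTotalDegree]

theorem brickState_mem_cutSpace (hT : IsSL3Generators T) {j k : ℕ} (h : 2 * j + 3 * k ≤ N) :
    brickState T j k ∈ cutSpace T N :=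
  mem_cutSpace.2 ⟨fun A => gaugeGenerator_brickState hT A j k,
    (brickState_isHomogeneous j k).totalDegree_le.trans h⟩

theorem span_brickState (hT : IsSL3Generators T) (N : ℕ) :
    Submodule.span ℂ (Set.range fun p : brickIndices N => brickState T p.1.1 p.1.2) =
      cutSpace T N := by
  refine le_antisymm (Submodule.span_le.2 ?_) fun P hP => ?_
  · rintro _ ⟨p, rfl⟩
    exact brickState_mem_cutSpace hT (mem_brickIndices.1 p.2)
  · obtain ⟨hgauge, hdegree⟩ := mem_cutSpace.1 hP
    have hspan := extendSlice_mem_span (T := T) (restrictSlice T P)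
    rw [extendSlice_restrictSlice hT hgauge] at hspan
    have hcut := Submodule.mem_map_of_mem (f := cutProjection N) hspan
    rw [cutProjection_of_totalDegree_le hdegree, Submodule.map_span] at hcut
    refine Submodule.span_le.2 ?_ hcut
    rintro _ ⟨_, ⟨p, rfl⟩, rfl⟩
    simp only [cutProjection_of_isHomogeneous N (brickState_isHomogeneous p.1 p.2)]
    split_ifs with hp
    · exact Submodule.subset_span ⟨⟨p, mem_brickIndices.2 hp⟩, rfl⟩
    · exact Submodule.zero_mem _

end CutSpace

section Laplacian

variable {σ R : Type*} [Fintype σ] [CommRing R]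

/-- The Laplacian `∑ ∂ᵢ²` on polynomials. -/
noncomputable def laplacian : Module.End R (MvPolynomial σ R) :=
  ∑ i, (pderiv i).toLinearMap * (pderiv i).toLinearMap

theorem laplacian_apply (p : MvPolynomial σ R) :
    laplacian p = ∑ i, pderiv i (pderiv i p) := by
  simp [laplacian]

theorem laplacian_mul (p q : MvPolynomial σ R) :
    laplacian (p * q) =
      p * laplacian q + q * laplacian p + 2 * ∑ i, pderiv i p * pderiv i q := by
  simp only [laplacian_apply, Derivation.leibniz, map_add, smul_eq_mul, Finset.mul_sum,
    ← Finset.sum_add_distrib]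
  exact Finset.sum_congr rfl fun i _ => by ring

theorem laplacian_pow (p : MvPolynomial σ R) (k : ℕ) :
    laplacian (p ^ k) = (k * p ^ (k - 1)) * laplacian p +
      (k * (k - 1 : ℕ) * p ^ (k - 2)) * ∑ i, pderiv i p ^ 2 := by
  simp only [laplacian_apply, Finset.mul_sum, ← Finset.sum_add_distrib]
  refine Finset.sum_congr rfl fun i _ => ?_
  simp only [pderiv_pow, Derivation.leibniz, Derivation.map_natCast, smul_eq_mul, mul_zero,
    add_zero, Nat.sub_sub, Nat.reduceAdd]
  ring

variable {q : MvPolynomial σ R}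

theorem laplacian_pow_of_pderiv_eq_X (hq : q.IsHomogeneous 2) (hX : ∀ i, pderiv i q = X i)
    (n : ℕ) :
    laplacian (q ^ n) = ((n * (Fintype.card σ + 2 * (n - 1 : ℕ)) : ℕ) : R) • q ^ (n - 1) := by
  have hgradient : ∑ i, X i ^ 2 = 2 * q := by
    simpa [hX, ← sq] using hq.sum_X_mul_pderiv
  rw [laplacian_pow]
  simp only [laplacian_apply, hX, pderiv_X_self, Finset.sum_const, Finset.card_univ, hgradient,
    nsmul_eq_mul, smul_eq_C_mul, map_natCast]
  rcases n with _ | _ | n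
  · simp
  · simp
  · simp only [Nat.add_sub_cancel, Nat.reduceSubDiff]
    push_cast
    ring

theorem laplacian_pow_mul_of_pderiv_eq_X (hq : q.IsHomogeneous 2) (hX : ∀ i, pderiv i q = X i)
    {m : ℕ} {g : MvPolynomial σ R} (hg : g.IsHomogeneous m) (n : ℕ) :
    laplacian (q ^ n * g) = q ^ n * laplacian g +
      ((n * (Fintype.card σ + 2 * (n - 1 : ℕ) + 2 * m) : ℕ) : R) • (q ^ (n - 1) * g) := by
  have hEuler : ∑ i, pderiv i (q ^ n) * pderiv i g = n * q ^ (n - 1) * (m * g) := by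
    simp only [pderiv_pow, hX, mul_assoc, ← Finset.mul_sum, hg.sum_X_mul_pderiv, nsmul_eq_mul]
  rw [laplacian_mul, laplacian_pow_of_pderiv_eq_X hq hX, hEuler]
  simp only [smul_eq_C_mul, map_natCast]
  push_cast
  ring

end Laplacian

section Hamiltonian

variable {T : Fin 8 → Matrix (Fin 3) (Fin 3) ℂ}

theorem sum_coord_mul_coord (hT : IsSL3Generators T) {R : Type*} [CommRing R] [Algebra ℂ R]
    (Y Z : Matrix (Fin 3) (Fin 3) R) :
    ∑ A, coord T Y A * coord T Z A =
      (2 : ℂ) • (Y * Z).trace - (2 / 3 : ℂ) • (Y.trace * Z.trace) := by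
  have h := congrArg (fun W => (2 : ℂ) • (W * Z).trace) (matrixOf_coord_add hT Y)
  simp only [matrixOf_eq_sum, add_mul, Finset.sum_mul, Matrix.trace_add, Matrix.trace_sum,
    Matrix.smul_mul, Matrix.trace_smul, one_mul, smul_eq_mul] at h
  rw [← h, smul_add, Finset.smul_sum, smul_mul_assoc, smul_smul]
  norm_num
  refine Finset.sum_congr rfl fun A _ => ?_
  rw [coord_apply Z, Algebra.smul_def, map_ofNat]
  ring

theorem map_pderiv_genericMatrix (A : Fin 8) :
    (genericMatrix T).map (pderiv A) = (T A).map (algebraMap ℂ Fock) := by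
  ext1 i j
  simp [genericMatrix, matrixOf_eq_sum, Matrix.sum_apply, pderiv_X, Pi.single_apply]

theorem derivation_coord {R : Type*} [CommRing R] [Algebra ℂ R] (D : Derivation ℂ R R)
    (Y : Matrix (Fin 3) (Fin 3) R) (A : Fin 8) : D (coord T Y A) = coord T (Y.map D) A := by
  have htwo : D 2 = 0 := D.map_natCast 2
  simp [coord_apply, Matrix.trace, Matrix.mul_apply, htwo]

theorem pderiv_powerTrace (k : ℕ) (A : Fin 8) :
    pderiv A (powerTrace T (k + 1)) = ((k + 1) / 2 : ℂ) • coord T (genericMatrix T ^ k) A := by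
  have hscalar : C ((k + 1) / 2 : ℂ) * 2 = (k + 1 : Fock) := by
    rw [← map_ofNat C 2, ← map_mul, div_mul_cancel₀ _ two_ne_zero]
    simp
  rw [powerTrace, derivation_trace_pow, map_pderiv_genericMatrix, Matrix.trace_mul_comm,
    coord_apply, smul_eq_C_mul, ← mul_assoc, hscalar]

theorem pderiv_powerTrace_two (hT : IsSL3Generators T) (A : Fin 8) :
    pderiv A (powerTrace T 2) = X A := by
  rw [pderiv_powerTrace, pow_one, genericMatrix, coord_matrixOf hT]
  norm_num

theorem sum_pderiv_powerTrace_three_sq (hT : IsSL3Generators T) :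
    ∑ A, pderiv A (powerTrace T 3) ^ 2 = (3 / 4 : ℂ) • powerTrace T 2 ^ 2 := by
  simp only [pderiv_powerTrace, smul_pow, ← Finset.smul_sum, sq (coord T _ _)]
  rw [sum_coord_mul_coord hT, ← pow_add, genericMatrix, trace_pow_four (trace_matrixOf hT X), ← sq,
    powerTrace, genericMatrix]
  push_cast
  module

theorem laplacian_powerTrace_three (hT : IsSL3Generators T) : laplacian (powerTrace T 3) = 0 := by
  have hcasimir : ∑ A, (T A).map (algebraMap ℂ Fock) * (T A).map (algebraMap ℂ Fock) =
      (4 / 3 : ℂ) • (1 : Matrix (Fin 3) (Fin 3) Fock) := by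
    have h := congrArg (AlgHom.mapMatrix (m := Fin 3) (Algebra.ofId ℂ Fock))
      (sum_generator_mul_self hT)
    rwa [map_sum, map_smul, map_one, Finset.sum_congr rfl fun A _ => map_mul _ (T A) (T A)] at h
  have h : ∀ A, pderiv A (pderiv A (powerTrace T 3)) = C 6 *
      ((T A).map (algebraMap ℂ Fock) * (T A).map (algebraMap ℂ Fock) * genericMatrix T).trace := by
    intro A
    rw [pderiv_powerTrace, Derivation.map_smul, derivation_coord, sq, map_derivation_mul,
      map_pderiv_genericMatrix, coord_apply, mul_add, Matrix.trace_add, ← mul_assoc, ← mul_assoc,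
      Matrix.trace_mul_comm (_ * genericMatrix T), ← mul_assoc, smul_eq_C_mul, ← two_mul,
      ← map_ofNat C 2, ← mul_assoc, ← mul_assoc, ← map_mul, ← map_mul]
    norm_num
  simp only [laplacian_apply, h, ← Finset.mul_sum, ← Matrix.trace_sum, ← Finset.sum_mul, hcasimir]
  simp [genericMatrix, trace_matrixOf hT]

theorem laplacian_brickState (hT : IsSL3Generators T) (j k : ℕ) :
    laplacian (brickState T j k) =
      (2 * j * (j + 3 + 3 * k) : ℂ) • brickState T (j - 1) k +
      ((3 / 4) * k * (k - 1) : ℂ) • brickState T (j + 2) (k - 2) := by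
  simp only [brickState_eq]
  rw [laplacian_pow_mul_of_pderiv_eq_X (powerTrace_isHomogeneous 2) (pderiv_powerTrace_two hT)
    ((powerTrace_isHomogeneous 3).pow k), laplacian_pow, laplacian_powerTrace_three hT,
    sum_pderiv_powerTrace_three_sq hT]
  have hj : ((j * (Fintype.card (Fin 8) + 2 * (j - 1) + 2 * (3 * k)) : ℕ) : ℂ) =
      2 * j * (j + 3 + 3 * k) := by
    cases j <;> simp
    ring
  have hk : (3 / 4 * k * (k - 1) : ℂ) = 3 / 4 * (k * (k - 1 : ℕ) : ℕ) := by
    cases k <;> simp [mul_assoc]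
  rw [hj, hk]
  simp only [smul_eq_C_mul, map_mul, map_natCast, Nat.cast_mul, pow_add]
  ring

theorem trace_mul_of_generators (hT : IsSL3Generators T) {R : Type*} [Ring R] [Algebra ℂ R]
    (u v : Fin 8 → R) :
    ((Matrix.of fun i j => ∑ A, T A i j • u A : Matrix (Fin 3) (Fin 3) R) *
      (Matrix.of fun i j => ∑ A, T A i j • v A : Matrix (Fin 3) (Fin 3) R)).trace =
      (1 / 2 : ℂ) • ∑ A, u A * v A := by
  have h : ∀ A B, ∑ i, ∑ j, (T A i j * T B j i) • (u A * v B) =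
      (if A = B then 1 / 2 else 0 : ℂ) • (u A * v B) := fun A B => by
    simp only [← hT.2 A B, Matrix.trace, Matrix.diag, Matrix.mul_apply, Finset.sum_smul]
  simp only [Matrix.trace, Matrix.diag, Matrix.mul_apply, Matrix.of_apply, Finset.sum_mul_sum,
    smul_mul_smul_comm]
  calc ∑ i, ∑ j, ∑ A, ∑ B, (T A i j * T B j i) • (u A * v B)
      = ∑ A, ∑ B, ∑ i, ∑ j, (T A i j * T B j i) • (u A * v B) := by
        simp only [Fin.sum_univ_three, Finset.sum_add_distrib]
    _ = (1 / 2 : ℂ) • ∑ A, u A * v A := by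
        simp only [h, ite_smul, zero_smul, Finset.sum_ite_eq, Finset.mem_univ, if_true,
          Finset.smul_sum]

theorem hamiltonian_apply (hT : IsSL3Generators T) {m : ℕ} {p : Fock} (hp : p.IsHomogeneous m) :
    hamiltonian T p =
      (m / 2 + 2 : ℂ) • p - (1 / 2 : ℂ) • (powerTrace T 2 * p) - (1 / 4 : ℂ) • laplacian p := by
  have hnumber : (creationMatrix T * annihilationMatrix T).trace p = (m / 2 : ℂ) • p := by
    have hEuler : ∑ A, creation A (annihilation A p) = m • p := hp.sum_X_mul_pderiv
    have htrace : (creationMatrix T * annihilationMatrix T).trace =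
        (1 / 2 : ℂ) • ∑ A, creation A * annihilation A := trace_mul_of_generators hT _ _
    simp only [htrace, LinearMap.smul_apply, LinearMap.sum_apply, Module.End.mul_apply, hEuler]
    module
  have hcreation : (creationMatrix T * creationMatrix T).trace p = powerTrace T 2 * p := by
    rw [← sq, trace_creationMatrix_pow, Algebra.coe_lmul_eq_mul, LinearMap.mul_apply']
  have hannihilation :
      (annihilationMatrix T * annihilationMatrix T).trace p = (1 / 2 : ℂ) • laplacian p :=
    DFunLike.congr_fun (trace_mul_of_generators hT annihilation annihilation) p
  simp only [hamiltonian, LinearMap.sub_apply, LinearMap.add_apply, LinearMap.smul_apply, hnumber,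
    hcreation, hannihilation, Module.End.one_apply]
  module

end Hamiltonian

section Harmonics

variable {T : Fin 8 → Matrix (Fin 3) (Fin 3) ℂ}

/-- The coefficient of `|3t, K - 2t⟩` in the harmonic polynomial with leading term `|0, K⟩`; it is
`Γ^even_{κ-1,κ-t}` for `K = 2κ` and `Γ^odd_{κ-1,κ-t}` for `K = 2κ + 1`. -/
noncomputable def harmonicCoeff (K t : ℕ) : ℂ :=
  (K - t).choose t / (-24) ^ t

theorem harmonicCoeff_zero (K : ℕ) : harmonicCoeff K 0 = 1 := by
  simp [harmonicCoeff]

theorem harmonicCoeff_ne_zero {K t : ℕ} (h : 2 * t ≤ K) : harmonicCoeff K t ≠ 0 :=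
  div_ne_zero (Nat.cast_ne_zero.2 (Nat.choose_pos (by lia)).ne')
    (pow_ne_zero _ (by norm_num))

theorem harmonicCoeff_eq_zero {K t : ℕ} (h : K < 2 * t) : harmonicCoeff K t = 0 := by
  rw [harmonicCoeff, Nat.choose_eq_zero_of_lt (by lia), Nat.cast_zero, zero_div]

theorem harmonicCoeff_eq_factorial {K t : ℕ} (h : 2 * t ≤ K) :
    harmonicCoeff K t =
      (-24 : ℂ) ^ (-t : ℤ) * ((K - t).factorial / (t.factorial * (K - 2 * t).factorial)) := by
  rw [harmonicCoeff, Nat.cast_choose ℂ (by lia : t ≤ K - t), show K - t - t = K - 2 * t by lia,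
    zpow_neg, zpow_natCast]
  ring

theorem harmonicCoeff_succ (u t : ℕ) :
    harmonicCoeff (2 * t + u) (t + 1) * (18 * (t + 1) * (t + u)) =
      -(harmonicCoeff (2 * t + u) t * (3 / 4 * u * (u - 1))) := by
  rcases u with _ | _ | u
  · simp [harmonicCoeff_eq_zero]
  · simp [harmonicCoeff_eq_zero (by lia : 2 * t + 1 < 2 * (t + 1))]
  · rw [harmonicCoeff, harmonicCoeff, show 2 * t + (u + 1 + 1) - (t + 1) = t + 1 + u by lia,
      show 2 * t + (u + 1 + 1) - t = t + 1 + u + 1 by lia, Nat.cast_add_choose,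
      Nat.cast_choose ℂ (by lia : t ≤ t + 1 + u + 1),
      show t + 1 + u + 1 - t = u + 1 + 1 by lia]
    simp only [Nat.factorial_succ, pow_succ]
    have hu : (u : ℂ) + 1 + 1 ≠ 0 := mod_cast (u + 1).succ_ne_zero
    push_cast
    field_simp
    ring

/-- The harmonic polynomial in the two trace invariants with leading term `|0, K⟩`. -/
noncomputable def harmonic (T : Fin 8 → Matrix (Fin 3) (Fin 3) ℂ) (K : ℕ) : Fock :=
  ∑ t ∈ Finset.range (K / 2 + 1), harmonicCoeff K t • brickState T (3 * t) (K - 2 * t)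

theorem harmonic_isHomogeneous (K : ℕ) : (harmonic T K).IsHomogeneous (3 * K) := by
  refine IsHomogeneous.sum _ _ _ fun t ht => ?_
  have ht' := Finset.mem_range.1 ht
  rw [show 3 * K = 2 * (3 * t) + 3 * (K - 2 * t) by lia]
  exact (homogeneousSubmodule (Fin 8) ℂ _).smul_mem _ (brickState_isHomogeneous _ _)

theorem laplacian_harmonic (hT : IsSL3Generators T) (K : ℕ) : laplacian (harmonic T K) = 0 := by
  set lower : ℕ → Fock := fun t => harmonicCoeff K t •
    (2 * (3 * t : ℕ) * ((3 * t : ℕ) + 3 + 3 * (K - 2 * t : ℕ)) : ℂ) •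
      brickState T (3 * t - 1) (K - 2 * t)
  have hshift : ∑ t ∈ Finset.range (K / 2 + 1), lower t =
      ∑ t ∈ Finset.range (K / 2 + 1), lower (t + 1) := by
    have hlast : lower (K / 2 + 1) = 0 := by
      simp only [lower, harmonicCoeff_eq_zero (by lia : K < 2 * (K / 2 + 1)), zero_smul]
    have hfirst : lower 0 = 0 := by simp [lower]
    rw [← add_zero (∑ t ∈ _, lower t), ← hlast, ← Finset.sum_range_succ, Finset.sum_range_succ',
      hfirst, add_zero]
  simp only [harmonic, map_sum, map_smul, laplacian_brickState hT, smul_add,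
    Finset.sum_add_distrib]
  rw [hshift, ← Finset.sum_add_distrib]
  refine Finset.sum_eq_zero fun t ht => ?_
  obtain ⟨u, rfl⟩ : ∃ u, K = 2 * t + u :=
    Nat.exists_eq_add_of_le (by have := Finset.mem_range.1 ht; lia)
  simp only [lower, Nat.add_sub_cancel_left]
  rcases u with _ | _ | u
  · simp [harmonicCoeff_eq_zero]
  · simp [harmonicCoeff_eq_zero (by lia : 2 * t + 1 < 2 * (t + 1))]
  · rw [show 3 * (t + 1) - 1 = 3 * t + 2 by lia, show u + 1 + 1 - 2 = u by lia,
      show 2 * t + (u + 1 + 1) - 2 * (t + 1) = u by lia, smul_smul, smul_smul, ← add_smul]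
    refine smul_eq_zero_of_left ?_ _
    have hsucc := harmonicCoeff_succ (u + 1 + 1) t
    push_cast at hsucc ⊢
    linear_combination hsucc

end Harmonics

section Sectors

variable {T : Fin 8 → Matrix (Fin 3) (Fin 3) ℂ}

/-- The state `tr(a†a†)^n` times the harmonic polynomial with leading term `|0, K⟩`: the paper's
overlined `|n, K⟩`. For fixed `K` these states span a sector preserved by the Hamiltonian. -/
noncomputable def sectorState (T : Fin 8 → Matrix (Fin 3) (Fin 3) ℂ) (n K : ℕ) : Fock :=
  powerTrace T 2 ^ n * harmonic T K

theorem sectorState_eq_sum (n K : ℕ) : sectorState T n K =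
    ∑ t ∈ Finset.range (K / 2 + 1), harmonicCoeff K t • brickState T (n + 3 * t) (K - 2 * t) := by
  simp only [sectorState, harmonic, Finset.mul_sum, mul_smul_comm, brickState_eq, pow_add,
    mul_assoc]

theorem sectorState_eq_add_sum (n K : ℕ) : sectorState T n K =
    brickState T n K + ∑ t ∈ Finset.Icc 1 (K / 2),
      harmonicCoeff K t • brickState T (n + 3 * t) (K - 2 * t) := by
  rw [sectorState_eq_sum, Finset.range_eq_Ico, Finset.sum_eq_sum_Ico_succ_bot (Nat.succ_pos _),
    harmonicCoeff_zero, one_smul]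
  rfl

theorem mixedEven_eq (n κ : ℕ) : mixedEven T n κ = sectorState T n (2 * κ) := by
  rw [sectorState_eq_add_sum, mixedEven, Nat.mul_div_cancel_left _ two_pos]
  refine congrArg _ (Finset.sum_congr rfl fun t ht => ?_)
  obtain ⟨u, rfl⟩ := Nat.exists_eq_add_of_le' (Finset.mem_Icc.1 ht).2
  rw [harmonicCoeff_eq_factorial (by lia), gammaEven, Nat.add_sub_cancel,
    Nat.add_sub_cancel_left, show u + t + u = 2 * (u + t) - t by lia,
    show 2 * u = 2 * (u + t) - 2 * t by lia]
  simp

theorem mixedOdd_eq (n κ : ℕ) : mixedOdd T n κ = sectorState T n (2 * κ + 1) := by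
  rw [sectorState_eq_add_sum, mixedOdd, show (2 * κ + 1) / 2 = κ by lia]
  refine congrArg _ (Finset.sum_congr rfl fun t ht => ?_)
  obtain ⟨u, rfl⟩ := Nat.exists_eq_add_of_le' (Finset.mem_Icc.1 ht).2
  rw [harmonicCoeff_eq_factorial (by lia), gammaOdd, Nat.add_sub_cancel,
    Nat.add_sub_cancel_left, show u + t + u + 1 = 2 * (u + t) + 1 - t by lia,
    show 2 * u + 1 = 2 * (u + t) + 1 - 2 * t by lia,
    show 2 * (u + t) - 2 * t + 1 = 2 * (u + t) + 1 - 2 * t by lia]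
  simp

theorem sectorState_isHomogeneous (n K : ℕ) :
    (sectorState T n K).IsHomogeneous (2 * n + 3 * K) :=
  ((powerTrace_isHomogeneous 2).pow n).mul (harmonic_isHomogeneous K)

theorem laplacian_sectorState (hT : IsSL3Generators T) (n K : ℕ) :
    laplacian (sectorState T n K) =
      (2 * n * (n + 3 + 3 * K) : ℂ) • sectorState T (n - 1) K := by
  rw [sectorState, laplacian_pow_mul_of_pderiv_eq_X (powerTrace_isHomogeneous 2)
    (pderiv_powerTrace_two hT) (harmonic_isHomogeneous K), laplacian_harmonic hT, mul_zero,
    zero_add, sectorState]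
  congr 1
  rcases n with _ | n
  · simp
  · rw [Fintype.card_fin, Nat.add_sub_cancel]
    push_cast
    ring

theorem hamiltonian_sectorState (hT : IsSL3Generators T) (n K : ℕ) :
    hamiltonian T (sectorState T n K) =
      (n + 3 / 2 * K + 2 : ℂ) • sectorState T n K - (1 / 2 : ℂ) • sectorState T (n + 1) K -
        (1 / 2 * n * (n + 3 + 3 * K) : ℂ) • sectorState T (n - 1) K := by
  rw [hamiltonian_apply hT (sectorState_isHomogeneous n K), laplacian_sectorState hT,
    show powerTrace T 2 * sectorState T n K = sectorState T (n + 1) K by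
      rw [sectorState, sectorState, pow_succ', mul_assoc]]
  push_cast
  module

theorem sectorState_mem_cutSpace (hT : IsSL3Generators T) {N n K : ℕ} (h : 2 * n + 3 * K ≤ N) :
    sectorState T n K ∈ cutSpace T N := by
  rw [sectorState_eq_sum]
  refine Submodule.sum_mem _ fun t ht => Submodule.smul_mem _ _ (brickState_mem_cutSpace hT ?_)
  have := Finset.mem_range.1 ht
  lia

end Sectors

section Eigenstates

variable {T : Fin 8 → Matrix (Fin 3) (Fin 3) ℂ}

theorem mem_cutEigenspace {N : ℕ} {E : ℂ} {ψ : Fock} : ψ ∈ cutEigenspace T N E ↔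
    ψ ∈ cutSpace T N ∧ (cutProjection N * hamiltonian T) ψ = E • ψ := by
  simp [cutEigenspace, sub_eq_zero]

-- The three-term recurrence of the Laguerre polynomials cancels all but the last two terms.
theorem hamiltonian_sum_sectorState (hT : IsSL3Generators T) (K : ℕ) (E : ℂ) (m : ℕ) :
    hamiltonian T (∑ n ∈ Finset.range (m + 1),
        Polynomial.aeval (2 * E) (sonine n (3 * K + 3)) • sectorState T n K) =
      E • ∑ n ∈ Finset.range (m + 1),
        Polynomial.aeval (2 * E) (sonine n (3 * K + 3)) • sectorState T n K -
      (1 / 2 * Polynomial.aeval (2 * E) (sonine m (3 * K + 3))) • sectorState T (m + 1) K +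
      (1 / 2 * (m + 1) * (m + 4 + 3 * K) *
        Polynomial.aeval (2 * E) (sonine (m + 1) (3 * K + 3))) • sectorState T m K := by
  induction m with
  | zero =>
    have h := congrArg (Polynomial.aeval (2 * E)) (sonine_one (3 * K + 3))
    simp only [map_mul, map_sub, map_add, map_one, map_natCast, Polynomial.aeval_X] at h
    push_cast at h
    simp only [zero_add, Finset.sum_range_one, map_smul, hamiltonian_sectorState hT,
      Nat.cast_zero, mul_zero, zero_mul, zero_smul, sub_zero]
    match_scalars
    · linear_combination (-1 / 2) * h
    · ring
  | succ m ih =>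
    have h := congrArg (Polynomial.aeval (2 * E)) (sonine_recurrence m (3 * K + 3))
    simp only [map_mul, map_sub, map_add, map_natCast, map_ofNat, Polynomial.aeval_X] at h
    push_cast at h
    rw [Finset.sum_range_succ, map_add, ih, map_smul, hamiltonian_sectorState hT,
      Nat.add_sub_cancel]
    match_scalars
    · ring
    · linear_combination (-1 / 2) * h
    · ring
    · ring

/-- The number of the states `sectorState T n K` with at most `N` quanta, for `3 * K ≤ N`: it is
`d_κ` for `K = 2κ` and `d'_κ` for `K = 2κ + 1`. -/
def sectorDim (N K : ℕ) : ℕ := (N - 3 * K) / 2 + 1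

/-- The energies of the cut Hamiltonian in the sector `K`. -/
def sectorEnergies (N K : ℕ) : Set ℝ :=
  {E | (sonine (sectorDim N K) (3 * K + 3)).eval (2 * E) = 0}

/-- The solution in the sector `K` at the energy `E`, up to normalization. -/
noncomputable def sectorSolution (T : Fin 8 → Matrix (Fin 3) (Fin 3) ℂ) (N K : ℕ) (E : ℂ) :
    Fock :=
  ∑ n ∈ Finset.range (sectorDim N K),
    Polynomial.aeval (2 * E) (sonine n (3 * K + 3)) • sectorState T n K

theorem ncard_sectorEnergies (N K : ℕ) : (sectorEnergies N K).ncard = sectorDim N K :=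
  ncard_sonine_roots _ _

theorem finite_sectorEnergies (N K : ℕ) : (sectorEnergies N K).Finite :=
  Set.finite_of_ncard_ne_zero (ncard_sectorEnergies N K ▸ Nat.succ_ne_zero _)

theorem sectorEnergies_pos {N K : ℕ} {E : ℝ} (hE : E ∈ sectorEnergies N K) : 0 < E := by
  by_contra! h
  exact (sonine_eval_pos (sectorDim N K) (3 * K + 3) (by linarith : 2 * E ≤ 0)).ne' hE

theorem aeval_two_mul_ofReal (p : Polynomial ℝ) (E : ℝ) :
    Polynomial.aeval (2 * (E : ℂ)) p = ((p.eval (2 * E) : ℝ) : ℂ) := by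
  rw [← Complex.ofReal_ofNat, ← Complex.ofReal_mul]
  exact Polynomial.aeval_ofReal p (2 * E)

theorem aeval_sonine_sectorDim_eq_zero_iff {N K : ℕ} {E : ℂ} :
    Polynomial.aeval (2 * E) (sonine (sectorDim N K) (3 * K + 3)) = 0 ↔
      ∃ E' ∈ sectorEnergies N K, (E' : ℂ) = E := by
  constructor
  · intro h
    have hconj := conj_eq_of_aeval_sonine_eq_zero h
    rw [map_mul, Complex.conj_ofNat] at hconj
    obtain ⟨E', rfl⟩ := Complex.conj_eq_iff_real.1 (mul_left_cancel₀ two_ne_zero hconj)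
    rw [aeval_two_mul_ofReal, Complex.ofReal_eq_zero] at h
    exact ⟨E', h, rfl⟩
  · rintro ⟨E', hE', rfl⟩
    rw [aeval_two_mul_ofReal, Complex.ofReal_eq_zero]
    exact hE'

theorem sectorSolution_mem_cutSpace (hT : IsSL3Generators T) {N K : ℕ} (hK : 3 * K ≤ N) (E : ℂ) :
    sectorSolution T N K E ∈ cutSpace T N := by
  refine Submodule.sum_mem _ fun n hn => Submodule.smul_mem _ _ (sectorState_mem_cutSpace hT ?_)
  have := Finset.mem_range.1 hn
  rw [sectorDim] at this
  lia

theorem sectorSolution_mem_cutEigenspace (hT : IsSL3Generators T) {N K : ℕ} (hK : 3 * K ≤ N)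
    {E : ℝ} (hE : E ∈ sectorEnergies N K) :
    sectorSolution T N K E ∈ cutEigenspace T N E := by
  have hmem := sectorSolution_mem_cutSpace hT hK (E : ℂ)
  refine mem_cutEigenspace.2 ⟨hmem, ?_⟩
  have hH : hamiltonian T (sectorSolution T N K E) = (E : ℂ) • sectorSolution T N K E -
      (1 / 2 * Polynomial.aeval (2 * (E : ℂ)) (sonine ((N - 3 * K) / 2) (3 * K + 3))) •
        sectorState T (sectorDim N K) K := by
    have hroot := aeval_sonine_sectorDim_eq_zero_iff.2 ⟨E, hE, rfl⟩
    have h := hamiltonian_sum_sectorState hT K E ((N - 3 * K) / 2)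
    rw [← sectorDim, hroot, mul_zero, zero_smul, add_zero] at h
    exact h
  rw [Module.End.mul_apply, hH, map_sub, map_smul, map_smul,
    cutProjection_of_totalDegree_le (mem_cutSpace.1 hmem).2,
    cutProjection_of_isHomogeneous N (sectorState_isHomogeneous _ _),
    if_neg (by rw [sectorDim]; lia), smul_zero, sub_zero]

theorem inFamily_smul {N K : ℕ} {ψ : Fock} {c : ℂ} (hc : c ≠ 0) (h : InFamily T N K ψ) :
    InFamily T N K (c • ψ) := by
  obtain ⟨a, rfl, ha⟩ := h
  exact ⟨c • a, by simp only [Finset.smul_sum, smul_smul, Pi.smul_apply, smul_eq_mul],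
    by simpa [hc] using ha⟩

theorem ne_zero_of_inFamily (hT : IsSL3Generators T) {N K : ℕ} {ψ : Fock}
    (h : InFamily T N K ψ) : ψ ≠ 0 := by
  obtain ⟨a, rfl, ha⟩ := h
  obtain ⟨j, hj, hne⟩ := (ha K).2 ⟨le_rfl, rfl⟩
  exact fun h0 => hne (linearIndependent_iff'.1 (linearIndependent_brickState hT) _ a h0 _ hj)

/-- The coefficient of `|j, k⟩`, for `p = (j, k)`, in the combination `∑ n, s n • |n, K⟩` of the
sector states: the only contribution comes from `t = (K - k) / 2` and `n = j - 3 * t`. -/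
noncomputable def sectorCoeff (s : ℕ → ℂ) (K : ℕ) (p : ℕ × ℕ) : ℂ :=
  if (p.2 ≤ K ∧ p.2 % 2 = K % 2) ∧ 3 * ((K - p.2) / 2) ≤ p.1 then
    s (p.1 - 3 * ((K - p.2) / 2)) * harmonicCoeff K ((K - p.2) / 2) else 0

theorem sum_sectorState_eq_sum_brickState {N K : ℕ} (hK : 3 * K ≤ N) (s : ℕ → ℂ) :
    ∑ n ∈ Finset.range (sectorDim N K), s n • sectorState T n K =
      ∑ p ∈ brickIndices N, sectorCoeff s K p • brickState T p.1 p.2 := by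
  simp only [sectorState_eq_sum, Finset.smul_sum, smul_smul]
  rw [← Finset.sum_product' _ _ fun n t => (s n * harmonicCoeff K t) •
    brickState T (n + 3 * t) (K - 2 * t)]
  have hmem : ∀ q, q ∈ Finset.range (sectorDim N K) ×ˢ Finset.range (K / 2 + 1) ↔
      q.1 ≤ (N - 3 * K) / 2 ∧ 2 * q.2 ≤ K := fun q => by
    simp only [Finset.mem_product, Finset.mem_range, sectorDim]
    lia
  refine Finset.sum_of_injOn (fun q => (q.1 + 3 * q.2, K - 2 * q.2)) (fun q hq r hr h => ?_)
    (fun q hq => ?_) (fun p hp hnot => ?_) fun q hq => ?_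
  · have := (hmem q).1 hq
    have := (hmem r).1 hr
    simp only [Prod.mk.injEq] at h
    exact Prod.ext (by lia) (by lia)
  · have := (hmem q).1 hq
    exact mem_brickIndices.2 (by lia)
  · have := mem_brickIndices.1 hp
    rw [sectorCoeff, if_neg, zero_smul]
    exact fun h => hnot ⟨(p.1 - 3 * ((K - p.2) / 2), (K - p.2) / 2), (hmem _).2 (by lia),
      Prod.ext (by lia) (by lia)⟩
  · have := (hmem q).1 hq
    rw [sectorCoeff, if_pos (by lia), show (K - (K - 2 * q.2)) / 2 = q.2 by lia,
      Nat.add_sub_cancel]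

theorem inFamily_sum_sectorState {N K : ℕ} (hK : 3 * K ≤ N) {s : ℕ → ℂ} (hs : s 0 ≠ 0) :
    InFamily T N K (∑ n ∈ Finset.range (sectorDim N K), s n • sectorState T n K) := by
  refine ⟨sectorCoeff s K, sum_sectorState_eq_sum_brickState hK s, fun k => ⟨?_, fun hk => ?_⟩⟩
  · rintro ⟨j, -, hj⟩
    exact (by_contra fun h => hj (if_neg h) : _ ∧ _).1
  · refine ⟨3 * ((K - k) / 2), mem_brickIndices.2 (by lia), ?_⟩
    rw [sectorCoeff, if_pos ⟨hk, le_rfl⟩, Nat.sub_self]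
    exact mul_ne_zero hs (harmonicCoeff_ne_zero (by lia))

theorem inFamily_sectorSolution {N K : ℕ} (hK : 3 * K ≤ N) (E : ℂ) :
    InFamily T N K (sectorSolution T N K E) := by
  refine inFamily_sum_sectorState hK ?_
  simp [sonine_zero, Nat.factorial_ne_zero]

end Eigenstates

section Completeness

variable {T : Fin 8 → Matrix (Fin 3) (Fin 3) ℂ}

theorem finrank_cutSpace (hT : IsSL3Generators T) (N : ℕ) :
    Module.finrank ℂ (cutSpace T N) = (brickIndices N).card := by
  rw [← span_brickState hT]
  exact (finrank_span_eq_card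
    ((linearIndependent_brickState hT).comp _ Subtype.val_injective)).trans (Fintype.card_coe _)

theorem card_brickIndices (N : ℕ) :
    (brickIndices N).card = ∑ K ∈ Finset.range (N / 3 + 1), sectorDim N K := by
  rw [Finset.card_eq_sum_card_fiberwise (f := Prod.snd) (t := Finset.range (N / 3 + 1))]
  · refine Finset.sum_congr rfl fun K hK => ?_
    have := Finset.mem_range.1 hK
    rw [← Finset.card_range (sectorDim N K)]
    refine Finset.card_nbij' Prod.fst (fun n => (n, K)) (fun p hp => ?_) (fun n hn => ?_)
      (fun p hp => Prod.ext rfl (Finset.mem_filter.1 hp).2.symm) fun n _ => rfl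
    all_goals
      simp only [Finset.coe_filter, Set.mem_ofPred_eq, mem_brickIndices, Finset.coe_range,
        Set.mem_Iio, sectorDim] at *
      lia
  · intro p hp
    have := mem_brickIndices.1 hp
    exact Finset.mem_coe.2 (Finset.mem_range.2 (by lia))

-- The sector states are unitriangular in the states `|j, k⟩`, ordered by `k`.
theorem brickState_mem_span_sectorState {N j k : ℕ} (h : 2 * j + 3 * k ≤ N) :
    brickState T j k ∈
      Submodule.span ℂ ((fun p : ℕ × ℕ => sectorState T p.1 p.2) '' brickIndices N) := by
  induction k using Nat.strong_induction_on generalizing j with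
  | _ k ih =>
    rw [eq_sub_of_add_eq (sectorState_eq_add_sum j k).symm]
    refine Submodule.sub_mem _ (Submodule.subset_span ⟨(j, k), mem_brickIndices.2 h, rfl⟩)
      (Submodule.sum_mem _ fun t ht => Submodule.smul_mem _ _ ?_)
    have := Finset.mem_Icc.1 ht
    exact ih _ (by lia) (by lia)

theorem span_sectorState (hT : IsSL3Generators T) (N : ℕ) :
    Submodule.span ℂ ((fun p : ℕ × ℕ => sectorState T p.1 p.2) '' brickIndices N) =
      cutSpace T N := by
  refine le_antisymm (Submodule.span_le.2 ?_) ?_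
  · rintro _ ⟨p, hp, rfl⟩
    exact sectorState_mem_cutSpace hT (mem_brickIndices.1 hp)
  · rw [← span_brickState hT, Submodule.span_le]
    rintro _ ⟨p, rfl⟩
    exact brickState_mem_span_sectorState (mem_brickIndices.1 p.2)

-- Eigenvectors with distinct eigenvalues are independent, and there are as many of them as there
-- are sector states.
theorem span_sectorSolution_eq_span_sectorState (hT : IsSL3Generators T) {N K : ℕ}
    (hK : 3 * K ≤ N) :
    Submodule.span ℂ (Set.range fun E : sectorEnergies N K => sectorSolution T N K (E : ℝ)) =
      Submodule.span ℂ (Set.range fun n : Fin (sectorDim N K) => sectorState T n K) := by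
  have := (finite_sectorEnergies N K).fintype
  have hind : LinearIndependent ℂ
      fun E : sectorEnergies N K => sectorSolution T N K (E : ℝ) := by
    refine Module.End.eigenvectors_linearIndependent' (cutProjection N * hamiltonian T)
      (fun E : sectorEnergies N K => ((E : ℝ) : ℂ))
      (Complex.ofReal_injective.comp Subtype.val_injective) _ fun E => ?_
    exact Module.End.hasEigenvector_iff.2 ⟨Module.End.mem_eigenspace_iff.2
      (mem_cutEigenspace.1 (sectorSolution_mem_cutEigenspace hT hK E.2)).2,
      ne_zero_of_inFamily hT (inFamily_sectorSolution hK _)⟩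
  have := FiniteDimensional.span_of_finite ℂ
    (Set.finite_range fun n : Fin (sectorDim N K) => sectorState T n K)
  refine Submodule.eq_of_le_of_finrank_le (Submodule.span_le.2 ?_) ?_
  · rintro _ ⟨E, rfl⟩
    exact Submodule.sum_mem _ fun n hn => Submodule.smul_mem _ _
      (Submodule.subset_span ⟨⟨n, Finset.mem_range.1 hn⟩, rfl⟩)
  · rw [finrank_span_eq_card hind, ← Nat.card_eq_fintype_card, Nat.card_coe_set_eq,
      ncard_sectorEnergies]
    exact (finrank_range_le_card _).trans (Fintype.card_fin _).le

/-- Labels `(K, E)` of the solutions of all sectors present at cut-off `N`. -/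
abbrev SolutionIndex (N : ℕ) : Type := Σ K : Fin (N / 3 + 1), sectorEnergies N K

theorem three_mul_fst_le {N : ℕ} (p : SolutionIndex N) : 3 * (p.1 : ℕ) ≤ N := by
  lia

theorem span_sectorSolution (hT : IsSL3Generators T) (N : ℕ) :
    Submodule.span ℂ (Set.range fun p : SolutionIndex N => sectorSolution T N p.1 (p.2 : ℝ)) =
      cutSpace T N := by
  refine le_antisymm (Submodule.span_le.2 ?_) ?_
  · rintro _ ⟨p, rfl⟩
    exact sectorSolution_mem_cutSpace hT (three_mul_fst_le p) _
  · rw [← span_sectorState hT, Submodule.span_le]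
    rintro _ ⟨⟨n, K⟩, hp, rfl⟩
    replace hp : 2 * n + 3 * K ≤ N := mem_brickIndices.1 hp
    have hmem : sectorState T n K ∈
        Submodule.span ℂ (Set.range fun m : Fin (sectorDim N K) => sectorState T m K) :=
      Submodule.subset_span ⟨⟨n, by rw [sectorDim]; lia⟩, rfl⟩
    rw [← span_sectorSolution_eq_span_sectorState hT (by lia : 3 * K ≤ N)] at hmem
    refine Submodule.span_mono ?_ hmem
    rintro _ ⟨E, rfl⟩
    exact ⟨⟨⟨K, by lia⟩, E⟩, rfl⟩

instance (N : ℕ) : Finite (SolutionIndex N) :=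
  have := fun K => (finite_sectorEnergies N K).to_subtype
  inferInstance

theorem card_solutionIndex (N : ℕ) : Nat.card (SolutionIndex N) = (brickIndices N).card := by
  have := fun K => (finite_sectorEnergies N K).to_subtype
  simp only [Nat.card_sigma, Nat.card_coe_set_eq, ncard_sectorEnergies, card_brickIndices,
    Finset.sum_range]

theorem linearIndependent_sectorSolution (hT : IsSL3Generators T) (N : ℕ) :
    LinearIndependent ℂ fun p : SolutionIndex N => sectorSolution T N p.1 (p.2 : ℝ) := by
  have := Fintype.ofFinite (SolutionIndex N)
  rw [linearIndependent_iff_card_eq_finrank_span, Set.finrank, span_sectorSolution hT,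
    finrank_cutSpace hT, ← card_solutionIndex, Nat.card_eq_fintype_card]

end Completeness

section Eigenspaces

theorem span_range_inf_eigenspace {ι R M : Type*} [CommRing R] [IsDomain R] [AddCommGroup M]
    [Module R M] [Module.IsTorsionFree R M] (f : Module.End R M) {v : ι → M} {e : ι → R}
    (hv : ∀ i, f (v i) = e i • v i) (μ : R) :
    Submodule.span R (Set.range v) ⊓ f.eigenspace μ =
      Submodule.span R (v '' {i | e i = μ}) := by
  have hle : Submodule.span R (v '' {i | e i = μ}) ≤ f.eigenspace μ := by
    rw [Submodule.span_le]
    rintro _ ⟨i, rfl, rfl⟩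
    exact Module.End.mem_eigenspace_iff.2 (hv i)
  have hdisj : Disjoint (Submodule.span R (v '' {i | e i = μ}ᶜ)) (f.eigenspace μ) := by
    refine (f.eigenspaces_iSupIndep μ).symm.mono_left (Submodule.span_le.2 ?_)
    rintro _ ⟨i, hi, rfl⟩
    exact Submodule.mem_iSup_of_mem (e i) (Submodule.mem_iSup_of_mem hi
      (Module.End.mem_eigenspace_iff.2 (hv i)))
  rw [← Set.image_univ, ← Set.union_compl_self {i | e i = μ}, Set.image_union,
    Submodule.span_union, sup_inf_assoc_of_le _ hle, hdisj.eq_bot, sup_bot_eq]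

end Eigenspaces

section Families

variable {T : Fin 8 → Matrix (Fin 3) (Fin 3) ℂ}

theorem dEven_eq (N κ : ℕ) : dEven N κ = sectorDim N (2 * κ) := by
  rw [dEven, sectorDim]
  lia

theorem dOdd_eq (N κ : ℕ) : dOdd N κ = sectorDim N (2 * κ + 1) := by
  rw [dOdd, sectorDim]
  lia

theorem evenEnergies_eq (N κ : ℕ) : evenEnergies N κ = sectorEnergies N (2 * κ) := by
  rw [evenEnergies, sectorEnergies, dEven_eq, show 3 * (2 * κ) = 6 * κ by ring]

theorem oddEnergies_eq (N κ : ℕ) : oddEnergies N κ = sectorEnergies N (2 * κ + 1) := by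
  rw [oddEnergies, sectorEnergies, dOdd_eq, show 3 * (2 * κ + 1) + 3 = 6 * κ + 6 by ring]

theorem ncard_evenEnergies (N κ : ℕ) : (evenEnergies N κ).ncard = dEven N κ := by
  rw [evenEnergies_eq, dEven_eq, ncard_sectorEnergies]

theorem ncard_oddEnergies (N κ : ℕ) : (oddEnergies N κ).ncard = dOdd N κ := by
  rw [oddEnergies_eq, dOdd_eq, ncard_sectorEnergies]

theorem exists_evenState_eq_smul (N κ : ℕ) {E : ℝ} (hE : 0 < E) :
    ∃ c : ℂˣ, evenState T N κ E = c • sectorSolution T N (2 * κ) E := by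
  have hc : (((2 * E) ^ (3 * κ) * Real.exp (-E) : ℝ) : ℂ) ≠ 0 :=
    Complex.ofReal_ne_zero.2 (by positivity)
  refine ⟨Units.mk0 _ hc, ?_⟩
  simp only [evenState, sectorSolution, mixedEven_eq, dEven_eq, aeval_two_mul_ofReal,
    Units.smul_mk0, show 3 * (2 * κ) + 3 = 6 * κ + 3 by ring]

theorem exists_oddState_eq_smul (N κ : ℕ) {E : ℝ} (hE : 0 < E) :
    ∃ c : ℂˣ, oddState T N κ E = c • sectorSolution T N (2 * κ + 1) E := by
  have hc : (((2 * E) ^ (3 * (κ : ℝ) + 3 / 2) * Real.exp (-E) : ℝ) : ℂ) ≠ 0 :=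
    Complex.ofReal_ne_zero.2 (by positivity)
  refine ⟨Units.mk0 _ hc, ?_⟩
  simp only [oddState, sectorSolution, mixedOdd_eq, dOdd_eq, aeval_two_mul_ofReal,
    Units.smul_mk0, show 3 * (2 * κ + 1) + 3 = 6 * κ + 6 by ring]

theorem smul_sectorSolution_properties (hT : IsSL3Generators T) {N K : ℕ} (hK : 3 * K ≤ N)
    {E : ℝ} (hE : E ∈ sectorEnergies N K) (c : ℂˣ) :
    c • sectorSolution T N K E ≠ 0 ∧ c • sectorSolution T N K E ∈ cutEigenspace T N E ∧
      InFamily T N K (c • sectorSolution T N K E) :=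
  have hfam : InFamily T N K (c • sectorSolution T N K E) :=
    inFamily_smul c.ne_zero (inFamily_sectorSolution hK E)
  ⟨ne_zero_of_inFamily hT hfam,
    Submodule.smul_mem _ (c : ℂ) (sectorSolution_mem_cutEigenspace hT hK hE), hfam⟩

theorem evenState_properties (hT : IsSL3Generators T) {N κ : ℕ} (hκ : 6 * κ ≤ N) {E : ℝ}
    (hE : E ∈ evenEnergies N κ) : 0 < E ∧ evenState T N κ E ≠ 0 ∧
      evenState T N κ E ∈ cutEigenspace T N (E : ℂ) ∧
      InFamily T N (2 * κ) (evenState T N κ E) := by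
  rw [evenEnergies_eq] at hE
  obtain ⟨c, hc⟩ := exists_evenState_eq_smul (T := T) N κ (sectorEnergies_pos hE)
  rw [hc]
  exact ⟨sectorEnergies_pos hE, smul_sectorSolution_properties hT (by lia) hE c⟩

theorem oddState_properties (hT : IsSL3Generators T) {N κ : ℕ} (hκ : 6 * κ + 3 ≤ N) {E : ℝ}
    (hE : E ∈ oddEnergies N κ) : 0 < E ∧ oddState T N κ E ≠ 0 ∧
      oddState T N κ E ∈ cutEigenspace T N (E : ℂ) ∧
      InFamily T N (2 * κ + 1) (oddState T N κ E) := by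
  rw [oddEnergies_eq] at hE
  obtain ⟨c, hc⟩ := exists_oddState_eq_smul (T := T) N κ (sectorEnergies_pos hE)
  rw [hc]
  exact ⟨sectorEnergies_pos hE, smul_sectorSolution_properties hT (by lia) hE c⟩

/-- The bijection from the labels of the families `f_κ` and `g_κ` to the labels of the solutions
of all sectors: `f_κ` is the sector `2κ` and `g_κ` the sector `2κ + 1`. -/
def toSolutionIndex (N : ℕ) : EvenLabel N ⊕ OddLabel N → SolutionIndex N :=
  Sum.elim
    (fun p => ⟨⟨2 * p.1.1, by have := p.2.1; lia⟩, ⟨p.1.2, evenEnergies_eq N _ ▸ p.2.2⟩⟩)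
    (fun p => ⟨⟨2 * p.1.1 + 1, by have := p.2.1; lia⟩, ⟨p.1.2, oddEnergies_eq N _ ▸ p.2.2⟩⟩)

theorem energy_eq (N : ℕ) (s : EvenLabel N ⊕ OddLabel N) :
    energy N s = (toSolutionIndex N s).2 := by
  cases s <;> rfl

theorem toSolutionIndex_injective (N : ℕ) : Function.Injective (toSolutionIndex N) := by
  intro s t hst
  set label : SolutionIndex N → ℕ × ℝ := fun p => (p.1, p.2)
  have h := congrArg label hst
  rcases s with ⟨⟨κ, E⟩, _⟩ | ⟨⟨κ, E⟩, _⟩ <;> rcases t with ⟨⟨μ, F⟩, _⟩ | ⟨⟨μ, F⟩, _⟩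
  · obtain ⟨hκ, rfl⟩ : 2 * κ = 2 * μ ∧ E = F := Prod.mk.inj h
    obtain rfl : κ = μ := by lia
    rfl
  · have hκ : 2 * κ = 2 * μ + 1 := congrArg Prod.fst h
    lia
  · have hκ : 2 * κ + 1 = 2 * μ := congrArg Prod.fst h
    lia
  · obtain ⟨hκ, rfl⟩ : 2 * κ + 1 = 2 * μ + 1 ∧ E = F := Prod.mk.inj h
    obtain rfl : κ = μ := by lia
    rfl

theorem toSolutionIndex_surjective (N : ℕ) : Function.Surjective (toSolutionIndex N) := by
  rintro ⟨⟨K, hK⟩, ⟨E, hE⟩⟩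
  rcases Nat.even_or_odd' K with ⟨κ, rfl | rfl⟩
  · exact ⟨Sum.inl ⟨(κ, E), by lia, evenEnergies_eq N κ ▸ hE⟩, rfl⟩
  · exact ⟨Sum.inr ⟨(κ, E), by lia, oddEnergies_eq N κ ▸ hE⟩, rfl⟩

theorem exists_solution_eq_smul (N : ℕ) (s : EvenLabel N ⊕ OddLabel N) : ∃ c : ℂˣ,
    solution T N s =
      c • sectorSolution T N (toSolutionIndex N s).1 ((toSolutionIndex N s).2 : ℝ) := by
  have hpos := sectorEnergies_pos (toSolutionIndex N s).2.2
  rcases s with p | p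
  · exact exists_evenState_eq_smul N p.1.1 hpos
  · exact exists_oddState_eq_smul N p.1.1 hpos

theorem linearIndependent_solution (hT : IsSL3Generators T) (N : ℕ) :
    LinearIndependent ℂ (solution T N) := by
  choose c hc using exists_solution_eq_smul (T := T) N
  rw [funext hc]
  exact ((linearIndependent_sectorSolution hT N).comp _
    (toSolutionIndex_injective N)).units_smul c

theorem solution_mem_cutEigenspace (hT : IsSL3Generators T) (N : ℕ)
    (s : EvenLabel N ⊕ OddLabel N) : solution T N s ∈ cutEigenspace T N (energy N s) := by
  rcases s with p | p
  · exact (evenState_properties hT p.2.1 p.2.2).2.2.1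
  · exact (oddState_properties hT p.2.1 p.2.2).2.2.1

theorem span_solution (hT : IsSL3Generators T) (N : ℕ) :
    Submodule.span ℂ (Set.range (solution T N)) = cutSpace T N := by
  refine le_antisymm (Submodule.span_le.2 ?_) ?_
  · rintro _ ⟨s, rfl⟩
    exact (mem_cutEigenspace.1 (solution_mem_cutEigenspace hT N s)).1
  · rw [← span_sectorSolution hT, Submodule.span_le]
    rintro _ ⟨p, rfl⟩
    obtain ⟨s, rfl⟩ := toSolutionIndex_surjective N p
    obtain ⟨c, hc⟩ := exists_solution_eq_smul (T := T) N s
    have hmem : solution T N s ∈ Submodule.span ℂ (Set.range (solution T N)) :=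
      Submodule.subset_span ⟨s, rfl⟩
    rw [hc] at hmem
    exact (Submodule.smul_mem_iff' _ c).1 hmem

theorem cutEigenspace_eq (hT : IsSL3Generators T) (N : ℕ) (E : ℂ) : cutEigenspace T N E =
    Submodule.span ℂ (solution T N '' {s | (energy N s : ℂ) = E}) := by
  rw [cutEigenspace, ← span_solution hT, ← Module.End.eigenspace_def]
  exact span_range_inf_eigenspace _
    (fun s => (mem_cutEigenspace.1 (solution_mem_cutEigenspace hT N s)).2) E

end Families

section Spectrum

variable {T : Fin 8 → Matrix (Fin 3) (Fin 3) ℂ}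

theorem prod_range_eq_even_mul_odd {M : Type*} [CommMonoid M] (f : ℕ → M) (N : ℕ) :
    ∏ k ∈ Finset.range (N / 3 + 1), f k =
      (∏ κ ∈ (Finset.range (N + 1)).filter (fun κ => 6 * κ ≤ N), f (2 * κ)) *
      ∏ κ ∈ (Finset.range (N + 1)).filter (fun κ => 6 * κ + 3 ≤ N), f (2 * κ + 1) := by
  rw [← Finset.prod_filter_mul_prod_filter_not (Finset.range (N / 3 + 1)) (fun k => k % 2 = 0)]
  congr 1
  · refine Finset.prod_nbij' (fun k => k / 2) (fun κ => 2 * κ) ?_ ?_ ?_ ?_ fun k hk => ?_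
    on_goal 5 => rw [Nat.mul_div_cancel' (Nat.dvd_of_mod_eq_zero (Finset.mem_filter.1 hk).2)]
    all_goals
      simp only [Finset.mem_filter, Finset.mem_range]
      lia
  · refine Finset.prod_nbij' (fun k => k / 2) (fun κ => 2 * κ + 1) ?_ ?_ ?_ ?_ fun k hk => ?_
    on_goal 5 => rw [show 2 * (k / 2) + 1 = k by have := (Finset.mem_filter.1 hk).2; lia]
    all_goals
      simp only [Finset.mem_filter, Finset.mem_range]
      lia

theorem thetaPoly_eval (N : ℕ) (E : ℝ) : (thetaPoly N).eval E =
    (∏ κ ∈ (Finset.range (N + 1)).filter (fun κ => 6 * κ ≤ N),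
      (sonine (dEven N κ) (6 * κ + 3)).eval (2 * E)) *
    ∏ κ ∈ (Finset.range (N + 1)).filter (fun κ => 6 * κ + 3 ≤ N),
      (sonine (dOdd N κ) (6 * κ + 6)).eval (2 * E) := by
  rw [thetaPoly, prod_range_eq_even_mul_odd, Polynomial.eval_mul, Polynomial.eval_prod,
    Polynomial.eval_prod]
  simp only [Polynomial.eval_comp, Polynomial.eval_mul, Polynomial.eval_C, Polynomial.eval_X,
    dEven_eq, dOdd_eq, sectorDim, show ∀ κ, 3 * (2 * κ) + 3 = 6 * κ + 3 by intro; ring,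
    show ∀ κ, 3 * (2 * κ + 1) + 3 = 6 * κ + 6 by intro; ring]

theorem aeval_thetaPoly_eq_zero_iff (N : ℕ) (E : ℂ) : Polynomial.aeval E (thetaPoly N) = 0 ↔
    ∃ p : SolutionIndex N, ((p.2 : ℝ) : ℂ) = E := by
  have hdim (K : ℕ) : (N - 3 * K) / 2 + 1 = sectorDim N K := rfl
  simp only [thetaPoly, map_prod, Finset.prod_eq_zero_iff, Polynomial.aeval_comp, map_mul,
    Polynomial.aeval_X, map_ofNat, Finset.mem_range, hdim, aeval_sonine_sectorDim_eq_zero_iff]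
  constructor
  · rintro ⟨K, hK, E', hE', rfl⟩
    exact ⟨⟨⟨K, hK⟩, ⟨E', hE'⟩⟩, rfl⟩
  · rintro ⟨⟨⟨K, hK⟩, ⟨E', hE'⟩⟩, rfl⟩
    exact ⟨K, hK, E', hE', rfl⟩

theorem exists_solution_iff (hT : IsSL3Generators T) (N : ℕ) (E : ℂ) :
    (∃ ψ ∈ cutEigenspace T N E, ψ ≠ 0) ↔ Polynomial.aeval E (thetaPoly N) = 0 := by
  have hnonempty : (∃ p : SolutionIndex N, ((p.2 : ℝ) : ℂ) = E) ↔
      {s : EvenLabel N ⊕ OddLabel N | (energy N s : ℂ) = E}.Nonempty := by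
    simp only [(toSolutionIndex_surjective N).exists, ← energy_eq, Set.Nonempty,
      Set.mem_ofPred_eq]
  rw [aeval_thetaPoly_eq_zero_iff, hnonempty, ← Submodule.ne_bot_iff, cutEigenspace_eq hT]
  refine ⟨fun h => Set.nonempty_iff_ne_empty.2 fun h0 => h ?_, fun ⟨s, hs⟩ => ?_⟩
  · rw [h0, Set.image_empty, Submodule.span_empty]
  · exact (Submodule.ne_bot_iff _).2 ⟨solution T N s, Submodule.subset_span ⟨s, hs, rfl⟩,
      (linearIndependent_solution hT N).ne_zero s⟩

end Spectrum

end SU3Fock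

theorem mainTheorem1_general (T : Fin 8 → Matrix (Fin 3) (Fin 3) ℂ)
    (hT : SU3Fock.IsSL3Generators T) (N : ℕ) :
    (LinearIndependent ℂ (fun p : brickIndices N => brickState T p.1.1 p.1.2) ∧
      Submodule.span ℂ (Set.range fun p : brickIndices N => brickState T p.1.1 p.1.2)
        = cutSpace T N) ∧
    (∀ κ : ℕ, 6 * κ ≤ N →
      (evenEnergies N κ).ncard = dEven N κ ∧
      ∀ E ∈ evenEnergies N κ, 0 < E ∧ evenState T N κ E ≠ 0 ∧
        evenState T N κ E ∈ cutEigenspace T N (E : ℂ) ∧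
        InFamily T N (2 * κ) (evenState T N κ E)) ∧
    (∀ κ : ℕ, 6 * κ + 3 ≤ N →
      (oddEnergies N κ).ncard = dOdd N κ ∧
      ∀ E ∈ oddEnergies N κ, 0 < E ∧ oddState T N κ E ≠ 0 ∧
        oddState T N κ E ∈ cutEigenspace T N (E : ℂ) ∧
        InFamily T N (2 * κ + 1) (oddState T N κ E)) ∧
    (LinearIndependent ℂ (solution T N) ∧
      Submodule.span ℂ (Set.range (solution T N)) = cutSpace T N) ∧
    (∀ E : ℂ, cutEigenspace T N E =
      Submodule.span ℂ (solution T N '' {s | (energy N s : ℂ) = E})) ∧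
    (∀ E : ℝ, (thetaPoly N).eval E =
      (∏ κ ∈ (Finset.range (N + 1)).filter (fun κ => 6 * κ ≤ N),
        (sonine (dEven N κ) (6 * κ + 3)).eval (2 * E)) *
      ∏ κ ∈ (Finset.range (N + 1)).filter (fun κ => 6 * κ + 3 ≤ N),
        (sonine (dOdd N κ) (6 * κ + 6)).eval (2 * E)) ∧
    (∀ E : ℂ, (∃ ψ ∈ cutEigenspace T N E, ψ ≠ 0) ↔ Polynomial.aeval E (thetaPoly N) = 0) := by
  refine ⟨⟨?_, SU3Fock.span_brickState hT N⟩,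
    fun κ hκ => ⟨SU3Fock.ncard_evenEnergies N κ, fun E => SU3Fock.evenState_properties hT hκ⟩,
    fun κ hκ => ⟨SU3Fock.ncard_oddEnergies N κ, fun E => SU3Fock.oddState_properties hT hκ⟩,
    ⟨SU3Fock.linearIndependent_solution hT N, SU3Fock.span_solution hT N⟩,
    SU3Fock.cutEigenspace_eq hT N, SU3Fock.thetaPoly_eval N, SU3Fock.exists_solution_iff hT N⟩
  exact (SU3Fock.linearIndependent_brickState hT).comp _ Subtype.val_injective

theorem mainTheorem1 (T : Fin 8 → Matrix (Fin 3) (Fin 3) ℂ) (hT : IsSU3Generators T) (N : ℕ) :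
    -- the states `|j, k⟩` with `2j + 3k ≤ N` form a basis of the cut bosonic sector
    (LinearIndependent ℂ (fun p : brickIndices N => brickState T p.1.1 p.1.2) ∧
      Submodule.span ℂ (Set.range fun p : brickIndices N => brickState T p.1.1 p.1.2)
        = cutSpace T N) ∧
    -- the family `f_κ`: `d_κ` positive energies, each with its eigenstate
    (∀ κ : ℕ, 6 * κ ≤ N →
      (evenEnergies N κ).ncard = dEven N κ ∧
      ∀ E ∈ evenEnergies N κ, 0 < E ∧ evenState T N κ E ≠ 0 ∧
        evenState T N κ E ∈ cutEigenspace T N (E : ℂ) ∧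
        InFamily T N (2 * κ) (evenState T N κ E)) ∧
    -- the family `g_κ`: `d'_κ` positive energies, each with its eigenstate
    (∀ κ : ℕ, 6 * κ + 3 ≤ N →
      (oddEnergies N κ).ncard = dOdd N κ ∧
      ∀ E ∈ oddEnergies N κ, 0 < E ∧ oddState T N κ E ≠ 0 ∧
        oddState T N κ E ∈ cutEigenspace T N (E : ℂ) ∧
        InFamily T N (2 * κ + 1) (oddState T N κ E)) ∧
    -- these eigenstates form a basis of the cut bosonic sector
    (LinearIndependent ℂ (solution T N) ∧
      Submodule.span ℂ (Set.range (solution T N)) = cutSpace T N) ∧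
    -- there are no other solutions of the eigenvalue problem
    (∀ E : ℂ, cutEigenspace T N E =
      Submodule.span ℂ (solution T N '' {s | (energy N s : ℂ) = E})) ∧
    -- `Θ` is the product of all the quantization conditions
    (∀ E : ℝ, (thetaPoly N).eval E =
      (∏ κ ∈ (Finset.range (N + 1)).filter (fun κ => 6 * κ ≤ N),
        (sonine (dEven N κ) (6 * κ + 3)).eval (2 * E)) *
      ∏ κ ∈ (Finset.range (N + 1)).filter (fun κ => 6 * κ + 3 ≤ N),
        (sonine (dOdd N κ) (6 * κ + 6)).eval (2 * E)) ∧
    -- the spectrum is the set of the roots of `Θ`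
    (∀ E : ℂ, (∃ ψ ∈ cutEigenspace T N E, ψ ≠ 0) ↔ Polynomial.aeval E (thetaPoly N) = 0) :=
  mainTheorem1_general T hT.2 N
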